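/- Let $d\ge 1$ and let $\mathscr T_j=(V_j,\mathcal E_j)$, $j=1,\dots,d$, be rooted directed trees (directed graphs without circuits, connected, with a unique root $\mathsf{root}_j$, every other vertex $v$ having a unique parent $\mathsf{par}(v)$) which are leafless (every vertex has a child) and locally finite (every vertex has finitely many children). Let $\alpha_{v_j}$ be the depth of $v_j\in V_j$ (its distance from $\mathsf{root}_j$), and assume that the joint branching index is finite, that is, for each $j$ the depths of the vertices of $\mathscr T_j$ with at least two children are bounded. Put $V=V_1\times\cdots\times V_d$, $\mathsf{root}=(\mathsf{root}_1,\dots,\mathsf{root}_d)$, and for $v\in V$ let $\alpha_v=(\alpha_{v_1},\dots,\alpha_{v_d})\in\mathbb N^d$ and $|\alpha_v|=\sum_j\alpha_{v_j}$. Let $\mathsf{Chi}_j(v)$ be the set of all vertices obtained from $v$ by replacing $v_j$ by one of its children, let $\mathsf{par}_j(v)$ be obtained by replacing $v_j\ne\mathsf{root}_j$ by its parent, and let $\mathsf{sib}_j(v)=\mathsf{Chi}_j(\mathsf{par}_j(v))$ if $v_j\neq\mathsf{root}_j$, $\mathsf{sib}_j(v)=\emptyset$ otherwise. Let $a>0$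 be real and $$\lambda^{(j)}_w=\sqrt{\frac1{\mathrm{card}(\mathsf{Chi}_j(v))}}\,\sqrt{\frac{\alpha_{v_j}+1}{|\alpha_v|+a}}\qquad(w\in\mathsf{Chi}_j(v),\ v\in V,\ j=1,\dots,d).$$ Let $S_{\boldsymbol\lambda_{\mathfrak C_a}}=(S_1,\dots,S_d)$ be the tuple of bounded operators on $\ell^2(V)$ with $(S_jf)(v)=\lambda^{(j)}_v f(\mathsf{par}_j(v))$ if $v_j\ne\mathsf{root}_j$ and $(S_jf)(v)=0$ otherwise, and let $E=\bigcap_{j}\ker S_j^*$. For $F\subseteq\{1,\dots,d\}$ let $\Phi_F=\{v\in V: v_j\neq\mathsf{root}_j\Leftrightarrow j\in F\}$, and for $u\in\Phi_F$ let $\mathsf{sib}_F(u)$ be the set of all vertices obtained from $u$ by replacing each $u_j$, $j\in F$, by a child of $\mathsf{par}(u_j)$. These sets partition $\Phi_F$; let $\Omega_F$ contain exactly one element of each of them. For $u\in\Omega_F$, $F\ne\emptyset$, let $$\mathcal L_{u,F}=\Big\{f\in\ell^2(\mathsf{sib}_F(u)):\ \sum_{w\in\mathsf{sib}_i(v_G|u_i)}f(w)\lambda^{(i)}_w=0\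 \text{ for all } i\in F,\ G=F\setminus\{i\},\ v\in\mathsf{sib}_F(u)\Big\},$$ where $v_G|u_i$ has $j$-th coordinate $v_j$ for $j\in G$, $u_i$ for $j=i$, and $\mathsf{root}_j$ otherwise. Let $P_{\mathcal M}$ be the orthogonal projection of $\ell^2(V)$ onto $\mathcal M$ and $[e_{\mathsf{root}}]$ the span of the indicator function of $\{\mathsf{root}\}$. Then only finitely many of the spaces $\mathcal L_{u,F}$ ($F\neq\emptyset$, $u\in\Omega_F$) are nonzero, and there is a reproducing kernel Hilbert space $\mathscr H_{a,d}$ of $E$-valued holomorphic functions on the open unit ball $\mathbb B^d$ of $\mathbb C^d$ on which the multiplications $(\mathscr M_{z_j}h)(z)=z_jh(z)$, $j=1,\dots,d$, are bounded operators, together with a unitary $U:\ell^2(V)\to\mathscr H_{a,d}$ with $US_j=\mathscr M_{z_j}U$ for $j=1,\dots,d$, such that the reproducing kernel $\kappa:\mathbb B^d\times\mathbb B^d\to B(E)$ of $\mathscr H_{a,d}$ is given, as an identity of operators on $E$, by $$\kappa(z,w)=\frac1{(1-\langle z,w\rangle)^a}\,P_{[e_{\mathsf{root}}]}+\sum_{\emptyset\ne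 F\subseteq\{1,\dots,d\}}\ \sum_{u\in\Omega_F}\kappa_{u,F}(z,w),$$ $$\kappa_{u,F}(z,w)=\sum_{\alpha\in\mathbb N^d}\frac{\alpha_u!}{(\alpha_u+\alpha)!}\Big(\prod_{j=0}^{|\alpha|-1}(|\alpha_u|+a+j)\Big)z^\alpha\overline w^{\alpha}\,P_{\mathcal L_{u,F}}.$$ Here the scalar series in each $\kappa_{u,F}(z,w)$ converges for all $z,w\in\mathbb B^d$, as does $$\sum_{\alpha\in\mathbb N^d}\frac{a(a+1)\cdots(a+|\alpha|-1)}{\alpha!}z^\alpha\overline w^\alpha=\frac1{(1-\langle z,w\rangle)^{a}},\qquad \langle z,w\rangle=\sum_j z_j\overline{w_j}$$ (principal branch of the power). -/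

import Mathlib

open scoped BigOperators ENNReal ComplexConjugate

universe u

noncomputable section

/-- A locally finite, leafless, rooted directed tree with vertex set `V`: a directed graph which
has no circuits, is connected, has a unique root (vertex without parents), in which every other
vertex has a unique parent, every vertex has at least one child, and only finitely many. -/
structure DirTree (V : Type*) extends Digraph V where
  /-- no directed closed walk; in particular no loops and no circuits -/
  acyclic : ∀ v, ¬ Relation.TransGen Adj v v
  /-- any two vertices are joined by a path that disregards the direction of edges -/
  connected : ∀ u v, Relation.ReflTransGen (fun x y => Adj x y ∨ Adj y x) u v
  root : V
  /-- `root` is the one and only vertex without parents -/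
  isRoot_iff : ∀ v, (∀ u, ¬ Adj u v) ↔ v = root
  unique_parent : ∀ v, v ≠ root → ∃! u, Adj u v
  leafless : ∀ v, ∃ w, Adj v w
  locallyFinite : ∀ v, {w | Adj v w}.Finite

namespace DirTree

variable {V : Type*} (T : DirTree V)

/-- The finite set of children of `v`. -/
def chi (v : V) : Finset V := (T.locallyFinite v).toFinset

open Classical in
/-- The parent of a vertex `v ≠ root` (the value at the root is irrelevant). -/
def parent (v : V) : V := if h : ∃ u, T.Adj u v then h.choose else v

/-- The `n`-th generation: the `n`-fold children of the root. -/
def gen : ℕ → Set V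
  | 0 => {T.root}
  | n + 1 => {w | ∃ v ∈ gen n, T.Adj v w}

/-- The depth of `v`: the (unique) `n` such that `v` lies in the `n`-th generation. -/
def depth (v : V) : ℕ := sInf {n | v ∈ T.gen n}

/-- The set of branching vertices. -/
def branching : Set V := {v | 2 ≤ (T.chi v).card}

open Classical in
/-- The branching index, an element of `ℕ ∪ {∞}`. -/
def branchingIndex : ℕ∞ :=
  if T.branching.Nonempty then 1 + ⨆ w ∈ T.branching, (T.depth w : ℕ∞) else 0

/-- The siblings of `v` (including `v`); the root has none. -/
def sib (v : V) : Set V := {w | v ≠ T.root ∧ w ∈ T.chi (T.parent v)}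

theorem mem_chi {v w : V} : w ∈ T.chi v ↔ T.Adj v w := by simp [chi]

theorem adj_parent {v : V} (hv : v ≠ T.root) : T.Adj (T.parent v) v := by
  have h : ∃ u, T.Adj u v := (T.unique_parent v hv).exists
  rw [parent, dif_pos h]
  exact h.choose_spec

theorem ne_root_of_adj {u v : V} (h : T.Adj u v) : v ≠ T.root := fun hv =>
  (T.isRoot_iff v).2 hv u h

theorem parent_eq {u v : V} (h : T.Adj u v) : T.parent v = u :=
  (T.unique_parent v (T.ne_root_of_adj h)).unique (T.adj_parent (T.ne_root_of_adj h)) h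

end DirTree

/-- The Hilbert space `ℓ²(V)` of square summable complex functions on the vertex set
`V = V₁ × ⋯ × V_d` of the directed Cartesian product. -/
abbrev L2 {d : ℕ} (V : Fin d → Type*) : Type _ := lp (fun _ : (∀ j, V j) => ℂ) 2

namespace TreeProduct

variable {d : ℕ} {V : Fin d → Type*} (T : ∀ j, DirTree (V j))

/-- The root of the product. -/
def root : ∀ j, V j := fun j => (T j).root

/-- The depth `α_v ∈ ℕ^d` of a vertex `v` of the product. -/
def depth (v : ∀ j, V j) : Fin d → ℕ := fun j => (T j).depth (v j)

/-- `|α_v|`. -/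
def absDepth (v : ∀ j, V j) : ℕ := ∑ j, depth T v j

/-- `Chi_j(v)`: replace the `j`-th coordinate of `v` by one of its children. -/
def chi (j : Fin d) (v : ∀ j, V j) : Finset (∀ j, V j) :=
  ((T j).chi (v j)).map ⟨Function.update v j, Function.update_injective v j⟩

/-- `par_j(v)`: replace the `j`-th coordinate of `v` by its parent (used only if `v j` is not
a root). -/
def par (j : Fin d) (v : ∀ j, V j) : ∀ j, V j := Function.update v j ((T j).parent (v j))

open Classical in
/-- `sib_j(v) = Chi_j(par_j(v))` if `v j` is not a root, and `∅` otherwise. -/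
def sib (j : Fin d) (v : ∀ j, V j) : Finset (∀ j, V j) :=
  if v j = (T j).root then ∅ else chi T j (par T j v)

/-- The weight `λ^{(j)}_w` of the tree analog of the Szegő, Bergman and Drury–Arveson shifts: with
`v = par_j(w)` it is `√(1 / card Chi_j(v)) √((α_{v_j} + 1) / (|α_v| + a))`. -/
def weight (a : ℝ) (j : Fin d) (w : ∀ j, V j) : ℝ :=
  √(1 / ((chi T j (par T j w)).card : ℝ)) *
    √(((depth T (par T j w) j : ℝ) + 1) / ((absDepth T (par T j w) : ℝ) + a))

open Classical in
/-- The mapping `Λ^{(j)}` on all complex functions on `V` underlying the multishift. -/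
def shiftFun (a : ℝ) (j : Fin d) (f : (∀ j, V j) → ℂ) (v : ∀ j, V j) : ℂ :=
  if v j = (T j).root then 0 else (weight T a j v : ℂ) * f (par T j v)

theorem mem_chi_iff {j : Fin d} {u w : ∀ j, V j} :
    w ∈ chi T j u ↔ (T j).Adj (u j) (w j) ∧ ∀ k, k ≠ j → w k = u k := by
  simp only [chi, Finset.mem_map, DirTree.mem_chi, Function.Embedding.coeFn_mk]
  constructor
  · rintro ⟨x, hx, rfl⟩
    refine ⟨by simpa using hx, fun k hk => by simp [hk]⟩
  · rintro ⟨h1, h2⟩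
    refine ⟨w j, h1, ?_⟩
    funext k
    by_cases hk : k = j
    · subst hk; simp
    · simp [hk, h2 k hk]

theorem mem_chi_par {j : Fin d} {w : ∀ j, V j} (hw : w j ≠ (T j).root) :
    w ∈ chi T j (par T j w) := by
  rw [mem_chi_iff]
  refine ⟨by simpa [par] using (T j).adj_parent hw, fun k hk => by simp [par, hk]⟩

theorem par_eq_of_mem_chi {j : Fin d} {u w : ∀ j, V j} (h : w ∈ chi T j u) : par T j w = u := by
  rw [mem_chi_iff] at h
  funext k
  by_cases hk : k = j
  · subst hk; simpa [par] using (T k).parent_eq h.1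
  · simp [par, hk, h.2 k hk]

theorem card_mul_weight_sq_le {a : ℝ} (ha : 0 < a) {j : Fin d} {u : ∀ j, V j} :
    ((chi T j u).card : ℝ) * (√(1 / ((chi T j u).card : ℝ)) *
      √(((depth T u j : ℝ) + 1) / ((absDepth T u : ℝ) + a))) ^ 2 ≤ 1 + 1 / a := by
  have hle : (depth T u j : ℝ) ≤ absDepth T u := by
    exact_mod_cast Finset.single_le_sum (f := fun j => depth T u j)
      (fun _ _ => Nat.zero_le _) (Finset.mem_univ j)
  have h0 : (0 : ℝ) ≤ depth T u j := Nat.cast_nonneg _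
  have h1 : (0 : ℝ) ≤ absDepth T u := Nat.cast_nonneg _
  have hq : ((depth T u j : ℝ) + 1) / ((absDepth T u : ℝ) + a) ≤ 1 + 1 / a := by
    rw [div_le_iff₀ (by positivity)]
    have : (1 + 1 / a) * ((absDepth T u : ℝ) + a) = absDepth T u + a + absDepth T u / a + 1 := by
      field_simp
      ring
    rw [this]
    have : 0 ≤ (absDepth T u : ℝ) / a := by positivity
    linarith
  rw [mul_pow, Real.sq_sqrt (by positivity), Real.sq_sqrt (by positivity), ← mul_assoc]
  refine le_trans (mul_le_of_le_one_left (by positivity) ?_) hq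
  rw [mul_one_div]
  exact div_self_le_one _

theorem tsum_shiftFun_le {a : ℝ} (ha : 0 < a) (j : Fin d) (f : (∀ j, V j) → ℂ) :
    ∑' v, ENNReal.ofReal (‖shiftFun T a j f v‖ ^ 2) ≤
      ENNReal.ofReal (1 + 1 / a) * ∑' v, ENNReal.ofReal (‖f v‖ ^ 2) := by
  classical
  set c : (∀ j, V j) → ℝ := fun u => √(1 / ((chi T j u).card : ℝ)) *
      √(((depth T u j : ℝ) + 1) / ((absDepth T u : ℝ) + a)) with hc
  have key : ∀ v, ENNReal.ofReal (‖shiftFun T a j f v‖ ^ 2) ≤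
      ∑' u, if v ∈ chi T j u then ENNReal.ofReal (c u ^ 2 * ‖f u‖ ^ 2) else 0 := by
    intro v
    by_cases hv : v j = (T j).root
    · simp [shiftFun, hv]
    · refine le_trans (le_of_eq ?_) (ENNReal.le_tsum (par T j v))
      rw [if_pos (mem_chi_par T hv)]
      simp [shiftFun, hv, weight, hc, mul_pow]
  calc ∑' v, ENNReal.ofReal (‖shiftFun T a j f v‖ ^ 2)
      ≤ ∑' v, ∑' u, if v ∈ chi T j u then ENNReal.ofReal (c u ^ 2 * ‖f u‖ ^ 2) else 0 :=
        ENNReal.tsum_le_tsum key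
    _ = ∑' u, ∑' v, if v ∈ chi T j u then ENNReal.ofReal (c u ^ 2 * ‖f u‖ ^ 2) else 0 :=
        ENNReal.tsum_comm
    _ ≤ ∑' u, ENNReal.ofReal (1 + 1 / a) * ENNReal.ofReal (‖f u‖ ^ 2) := by
        refine ENNReal.tsum_le_tsum fun u => ?_
        rw [tsum_eq_sum (s := chi T j u) (fun v hv => by simp [hv])]
        rw [Finset.sum_congr rfl (fun v hv => if_pos hv), Finset.sum_const, nsmul_eq_mul,
          ← ENNReal.ofReal_natCast, ← ENNReal.ofReal_mul (by positivity),
          ← ENNReal.ofReal_mul (by positivity), ← mul_assoc]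
        exact ENNReal.ofReal_le_ofReal
          (mul_le_mul_of_nonneg_right (card_mul_weight_sq_le T ha) (by positivity))
    _ = _ := ENNReal.tsum_mul_left

theorem summable_sq (f : L2 V) : Summable fun v => ‖f v‖ ^ 2 := by
  have h := (memℓp_gen_iff (p := 2) (by norm_num)).1 (lp.memℓp f)
  simpa using h

theorem summable_shiftFun {a : ℝ} (ha : 0 < a) (j : Fin d) (f : L2 V) :
    Summable fun v => ‖shiftFun T a j f v‖ ^ 2 := by
  have h1 : ∑' v, ENNReal.ofReal (‖shiftFun T a j f v‖ ^ 2) ≠ ⊤ := by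
    refine ne_top_of_le_ne_top ?_ (tsum_shiftFun_le T ha j f)
    exact ENNReal.mul_ne_top ENNReal.ofReal_ne_top (summable_sq f).tsum_ofReal_ne_top
  have h2 := ENNReal.summable_toReal h1
  refine h2.congr fun v => ?_
  exact ENNReal.toReal_ofReal (by positivity)

theorem memℓp_shiftFun {a : ℝ} (ha : 0 < a) (j : Fin d) (f : L2 V) :
    Memℓp (shiftFun T a j f) 2 := by
  refine memℓp_gen ?_
  simpa using summable_shiftFun T ha j f

theorem norm_sq_eq (f : L2 V) : ‖f‖ ^ 2 = ∑' v, ‖f v‖ ^ 2 := by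
  have h := lp.norm_rpow_eq_tsum (p := 2) (by norm_num) f
  simpa using h

/-- The `j`-th component `S_j` of the multishift, a bounded operator on `ℓ²(V)`:
`(S_j f)(v) = λ^{(j)}_v f(par_j v)` if `v j` is not a root, and `0` otherwise. -/
def shift (a : ℝ) (ha : 0 < a) (j : Fin d) : L2 V →L[ℂ] L2 V :=
  LinearMap.mkContinuous
    { toFun := fun f => ⟨shiftFun T a j f, memℓp_shiftFun T ha j f⟩
      map_add' := fun f g => by
        ext v
        change shiftFun T a j (f + g : L2 V) v = shiftFun T a j f v + shiftFun T a j g v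
        by_cases h : v j = (T j).root <;> simp [shiftFun, h, mul_add]
      map_smul' := fun r f => by
        ext v
        by_cases h : v j = (T j).root <;> simp [shiftFun, h, mul_left_comm] }
    (√(1 + 1 / a)) (fun f => by
      refine abs_le_of_sq_le_sq' ?_ (by positivity) |>.2
      rw [mul_pow, Real.sq_sqrt (by positivity), norm_sq_eq, norm_sq_eq]
      have h := tsum_shiftFun_le T ha j f
      rw [← ENNReal.ofReal_tsum_of_nonneg (fun _ => by positivity) (summable_shiftFun T ha j f),
        ← ENNReal.ofReal_tsum_of_nonneg (fun _ => by positivity) (summable_sq f),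
        ← ENNReal.ofReal_mul (by positivity)] at h
      exact (ENNReal.ofReal_le_ofReal_iff
        (mul_nonneg (by positivity) (tsum_nonneg fun _ => by positivity))).1 h)

theorem shift_apply (a : ℝ) (ha : 0 < a) (j : Fin d) (f : L2 V) (v : ∀ j, V j) :
    shift T a ha j f v = shiftFun T a j f v := rfl

/-- The joint kernel `E` of the adjoints `S_1^*, …, S_d^*`. -/
def jointKernel (a : ℝ) (ha : 0 < a) : Submodule ℂ (L2 V) :=
  ⨅ j, (ContinuousLinearMap.adjoint (shift T a ha j)).ker

instance (a : ℝ) (ha : 0 < a) : CompleteSpace (jointKernel T a ha) := by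
  have h : IsClosed (jointKernel T a ha : Set (L2 V)) := by
    rw [jointKernel, Submodule.coe_iInf]
    exact isClosed_iInter fun j => ContinuousLinearMap.isClosed_ker _
  exact h.completeSpace_coe

/-- `Φ_F`: the vertices whose `j`-th coordinate is a root precisely for `j ∉ F`. -/
def Phi (F : Finset (Fin d)) : Set (∀ j, V j) := {v | ∀ j, v j ≠ (T j).root ↔ j ∈ F}

/-- `sib_F(u) = sib_{i_1} ⋯ sib_{i_k}(u)` for `F = {i_1, …, i_k}`: the coordinates in `F` are
replaced, independently of each other, by siblings, and the others are kept. -/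
def sibF (F : Finset (Fin d)) (u : ∀ j, V j) : Set (∀ j, V j) :=
  {v | (∀ j ∈ F, v j ∈ (T j).sib (u j)) ∧ ∀ j ∉ F, v j = u j}

/-- `Ω` picks, for each `F`, exactly one element of each class `sib_F(u)`, `u ∈ Φ_F`. -/
def IsIndexing (Ω : Finset (Fin d) → Set (∀ j, V j)) : Prop :=
  ∀ F, Ω F ⊆ Phi T F ∧ ∀ v ∈ Phi T F, ∃! u, u ∈ Ω F ∧ u ∈ sibF T F v

/-- `v_G`: replace the coordinates of `v` outside `G` by roots. -/
def restrictTo (G : Finset (Fin d)) (v : ∀ j, V j) : ∀ j, V j :=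
  fun j => if j ∈ G then v j else (T j).root

/-- The space `L_{u,F}` of all `f ∈ ℓ²(sib_F(u))` which solve the system of linear equations
`∑_{w ∈ sib_i(v_G | u_i)} f(w) λ^{(i)}_w = 0`, for `i ∈ F`, `G = F ∖ {i}` and `v ∈ sib_F(u)`. -/
def solutionSpace (a : ℝ) (u : ∀ j, V j) (F : Finset (Fin d)) : Submodule ℂ (L2 V) where
  carrier := {f | (∀ w, w ∉ sibF T F u → f w = 0) ∧
    ∀ i ∈ F, ∀ v ∈ sibF T F u,
      ∑ w ∈ sib T i (Function.update (restrictTo T (F.erase i) v) i (u i)),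
        f w * (weight T a i w : ℂ) = 0}
  zero_mem' := by simp
  add_mem' := by
    rintro f g ⟨hf, hf'⟩ ⟨hg, hg'⟩
    refine ⟨fun w hw => by simp [hf w hw, hg w hw], fun i hi v hv => ?_⟩
    simp [add_mul, Finset.sum_add_distrib, hf' i hi v hv, hg' i hi v hv]
  smul_mem' := by
    rintro r f ⟨hf, hf'⟩
    refine ⟨fun w hw => by simp [hf w hw], fun i hi v hv => ?_⟩
    simp [mul_assoc, ← Finset.mul_sum, hf' i hi v hv]

instance (a : ℝ) (u : ∀ j, V j) (F : Finset (Fin d)) : CompleteSpace (solutionSpace T a u F) := by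
  have hc : ∀ w : (∀ j, V j), Continuous fun f : L2 V => f w := fun w =>
    (lp.evalCLM ℂ (fun _ : (∀ j, V j) => ℂ) 2 w).continuous
  have h : IsClosed (solutionSpace T a u F : Set (L2 V)) := by
    have : (solutionSpace T a u F : Set (L2 V)) =
        (⋂ w, ⋂ (_ : w ∉ sibF T F u), {f : L2 V | f w = 0}) ∩
        ⋂ i ∈ F, ⋂ v ∈ sibF T F u, {f : L2 V |
          ∑ w ∈ sib T i (Function.update (restrictTo T (F.erase i) v) i (u i)),
            f w * (weight T a i w : ℂ) = 0} := by
      ext f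
      simp [solutionSpace]
    rw [this]
    refine IsClosed.inter ?_ ?_
    · exact isClosed_iInter fun w => isClosed_iInter fun _ =>
        isClosed_eq (hc w) continuous_const
    · exact isClosed_biInter fun i _ => isClosed_biInter fun v _ =>
        isClosed_eq (continuous_finsetSum _ fun w _ => (hc w).mul continuous_const)
          continuous_const
  exact h.completeSpace_coe

open Classical in
/-- The one-dimensional space `[e_root]`. -/
def rootSpace : Submodule ℂ (L2 V) := Submodule.span ℂ {lp.single 2 (root T) (1 : ℂ)}

instance : FiniteDimensional ℂ (rootSpace T) := by
  unfold rootSpace; infer_instance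

/-- The term `(α_u! / (α_u + α)!) ∏_{i < |α|} (|α_u| + a + i) z^α \bar w^α` of the series
`κ_{u,F}(z, w)`. -/
def kappaTerm (a : ℝ) (u : ∀ j, V j) (z w : EuclideanSpace ℂ (Fin d)) (α : Fin d → ℕ) : ℂ :=
  (((∏ j, ((depth T u j).factorial : ℝ)) / (∏ j, ((depth T u j + α j).factorial : ℝ)) *
    ∏ i ∈ Finset.range (∑ j, α j), ((absDepth T u : ℝ) + a + i) : ℝ) : ℂ) *
    ((∏ j, z j ^ α j) * ∏ j, conj (w j) ^ α j)

/-- The operator valued series `κ_{u,F}(z, w)`, as an operator on `ℓ²(V)`. -/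
def kappa (a : ℝ) (u : ∀ j, V j) (F : Finset (Fin d)) (z w : EuclideanSpace ℂ (Fin d)) :
    L2 V →L[ℂ] L2 V :=
  (∑' α, kappaTerm T a u z w α) • (solutionSpace T a u F).starProjection

end TreeProduct

end

/-!
The function model comes from the joint kernel `E` of the adjoint shifts. All weights `λ^{(j)}_w`
with `w ∈ Chi_j(v)` agree, so `f ∈ E` means that `f` sums to zero over every set `Chi_j(v)`.
This has three consequences.

* `E` is graded by depth, and its elements live on the finitely many vertices all of whose
  coordinates are roots or children of branching vertices
  (`mem_branchingSupport_of_mem_jointKernel`). The conditions involve one class `sib_F(u)` at a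
  time, so that on `E` the projection onto `L_{u,F}` is the restriction to `sib_F(u)`
  (`starProjection_solutionSpace`).
* `S_j` preserves `ker S_i^*` for `i ≠ j` (`adjoint_shift_shift_eq_zero`), and `S_j^* S_j` is a
  scalar `(β_j + 1) / (|β| + a)` on functions of depth `β`. Writing `c(β, α)` for the coefficient
  `kappaCoeff` of the kernel series, this gives
  `c(β, α + e_j) S_j^* S^{α + e_j} x = c(β, α) S^α x` for `x ∈ E` of depth `β`, and
  `S_j^* S^α x = 0` if `α_j = 0`. Hence the vectors `K_z x = ∑_α c(β, α) \bar z^α S^α x` satisfy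
  `S_j^* K_z x = \bar z_j K_z x` (`adjoint_shift_kernelMap`). The series converges in `ℓ²(V)`
  because `‖S^α x‖² = ‖x‖² / c(β, α)`.
* The vectors `S^α x` span a dense subspace (`eq_zero_of_inner_shiftMonomial_eq_zero`).

The Hilbert space of the model is `ℓ²(V)` itself, where `f` is regarded as the `E`-valued function
`z ↦ K_z^* f` on the ball. This function determines `f` by uniqueness of power series coefficients
and density, it is holomorphic as the sum of a power series, and the eigenvector equation says
that `S_j` acts as multiplication by `z_j`. The kernel is `K_z^* K_w`. Expanding `K_z y` for
`y ∈ E` of depth `β` and applying the eigenvector equation to `K_w x` yields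
`⟪K_z y, K_w x⟫ = (∑_α c(β, α) z^α \bar w^α) ⟪y, x⟫` (`inner_kernelMap_kernelMap`). So the kernel
is a diagonal operator on `E` whose entry at a vertex depends only on the depth of that vertex,
and the stated sum of projections is the same diagonal operator, as the root and the classes
`sib_F(u)` partition `V` and depth is constant on each class.
-/

noncomputable section

namespace TreeProduct

/-! ### The scalar power series -/

/-- The coefficient `(β! / (β + α)!) ∏_{i < |α|} (|β| + a + i)` of the kernel series attached to
a vertex of depth `β`. It is written `c(β, α)` in the comments. -/
def kappaCoeff {d : ℕ} (a : ℝ) (β α : Fin d → ℕ) : ℝ :=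
  (∏ j, ((β j).factorial : ℝ)) / (∏ j, ((β j + α j).factorial : ℝ)) *
    ∏ i ∈ Finset.range (∑ j, α j), (((∑ j, β j : ℕ) : ℝ) + a + i)

/-- Induction on multi-indices by raising one entry at a time. -/
theorem multiIndex_induction {d : ℕ} {p : (Fin d → ℕ) → Prop} (zero : p 0)
    (add_single : ∀ α j, p α → p (α + Pi.single j 1)) (α : Fin d → ℕ) : p α := by
  induction h : ∑ j, α j generalizing α with
  | zero =>
    have : α = 0 := by
      funext j
      exact (Finset.sum_eq_zero_iff.1 h) j (Finset.mem_univ j)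
    exact this ▸ zero
  | succ n ih =>
    obtain ⟨j, -, hj⟩ : ∃ j ∈ Finset.univ, 0 < α j := by
      by_contra! hc
      simp [Finset.sum_eq_zero fun j hj => Nat.le_zero.1 (hc j hj)] at h
    have hα : α - Pi.single j 1 + Pi.single j 1 = α := by
      funext k
      by_cases hk : k = j
      · subst hk; simp; omega
      · simp [hk]
    rw [← hα]
    refine add_single _ j (ih _ ?_)
    have : ∑ k, α k = ∑ k, (α - Pi.single j 1 : Fin d → ℕ) k + 1 := by
      conv_lhs => rw [← hα]
      simp [Finset.sum_add_distrib]
    omega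

variable {d : ℕ}

theorem kappaCoeff_pos {a : ℝ} (ha : 0 < a) (β α : Fin d → ℕ) : 0 < kappaCoeff a β α := by
  unfold kappaCoeff
  have := fun j : Fin d => Nat.factorial_pos (β j)
  have := fun j : Fin d => Nat.factorial_pos (β j + α j)
  refine mul_pos (div_pos (Finset.prod_pos fun j _ => by positivity)
    (Finset.prod_pos fun j _ => by positivity)) (Finset.prod_pos fun j _ => by positivity)

theorem kappaCoeff_zero_right (a : ℝ) (β : Fin d → ℕ) : kappaCoeff a β 0 = 1 := by
  have : (∏ j, ((β j).factorial : ℝ)) ≠ 0 :=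
    Finset.prod_ne_zero_iff.2 fun j _ => by positivity
  simp [kappaCoeff, this]

theorem kappaCoeff_zero_left (a : ℝ) (α : Fin d → ℕ) : kappaCoeff a 0 α =
    (∏ i ∈ Finset.range (∑ j, α j), (a + i)) / ∏ j, ((α j).factorial : ℝ) := by
  simp [kappaCoeff, div_eq_mul_inv, mul_comm]

theorem kappaCoeff_add_single (a : ℝ) (β α : Fin d → ℕ) (j : Fin d) :
    kappaCoeff a β (α + Pi.single j 1) * (((β + α) j : ℝ) + 1) =
      kappaCoeff a β α * (((∑ k, (β + α) k : ℕ) : ℝ) + a) := by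
  have h1 : ∑ k, (α + Pi.single j 1 : Fin d → ℕ) k = ∑ k, α k + 1 := by
    simp [Finset.sum_add_distrib]
  have h2 : (∏ k, ((β k + (α + Pi.single j 1 : Fin d → ℕ) k).factorial : ℝ)) =
      (∏ k, ((β k + α k).factorial : ℝ)) * (((β + α) j : ℝ) + 1) := by
    rw [← Finset.mul_prod_erase _ _ (Finset.mem_univ j),
      ← Finset.mul_prod_erase (Finset.univ) (fun k => ((β k + α k).factorial : ℝ))
        (Finset.mem_univ j)]
    have : ∏ k ∈ Finset.univ.erase j, ((β k + (α + Pi.single j 1 : Fin d → ℕ) k).factorial : ℝ) =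
        ∏ k ∈ Finset.univ.erase j, ((β k + α k).factorial : ℝ) :=
      Finset.prod_congr rfl fun k hk => by simp [Finset.ne_of_mem_erase hk]
    rw [this]
    simp only [Pi.add_apply, Pi.single_eq_same, ← add_assoc, Nat.factorial_succ]
    push_cast
    ring
  have h3 : (∏ k, ((β k + α k).factorial : ℝ)) ≠ 0 :=
    Finset.prod_ne_zero_iff.2 fun j _ => by positivity
  have h4 : ((β + α) j : ℝ) + 1 ≠ 0 := by positivity
  unfold kappaCoeff
  rw [h1, h2, Finset.prod_range_succ]
  simp only [Pi.add_apply, Finset.sum_add_distrib] at h4 ⊢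
  push_cast at h4 ⊢
  field_simp
  ring

/-- By `β! α! ≤ (β + α)!`, the coefficient at depth `β` is dominated by the one at the root for the
parameter `|β| + a`, so that all series reduce to the binomial series. -/
theorem kappaCoeff_le {a : ℝ} (ha : 0 < a) (β α : Fin d → ℕ) :
    kappaCoeff a β α ≤ kappaCoeff ((∑ j, β j : ℕ) + a) 0 α := by
  rw [kappaCoeff_zero_left, div_eq_mul_inv, mul_comm _ (∏ j, ((α j).factorial : ℝ))⁻¹, kappaCoeff]
  refine mul_le_mul_of_nonneg_right ?_ (Finset.prod_nonneg fun i _ => by positivity)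
  rw [← Finset.prod_div_distrib, ← Finset.prod_inv_distrib]
  refine Finset.prod_le_prod (fun j _ => by positivity) fun j _ => ?_
  rw [div_le_iff₀ (by positivity), inv_mul_eq_div, le_div_iff₀ (by positivity)]
  exact_mod_cast Nat.le_of_dvd (Nat.factorial_pos _)
    (Nat.factorial_mul_factorial_dvd_factorial_add _ _)

/-- The binomial series. -/
theorem hasSum_binomial (a : ℝ) {x : ℂ} (hx : ‖x‖ < 1) :
    HasSum (fun n : ℕ => (((∏ i ∈ Finset.range n, (a + i)) / (n.factorial : ℝ) : ℝ) : ℂ) * x ^ n)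
      ((1 - x) ^ (-(a : ℂ))) := by
  have h := (Complex.one_div_one_sub_cpow_hasFPowerSeriesOnBall_zero (a : ℂ)).hasSum (y := x)
    (by simpa [← ofReal_norm] using hx)
  rw [zero_add, one_div, ← Complex.cpow_neg] at h
  refine h.congr_fun fun n => ?_
  have h1 : (n.factorial : ℂ) * Ring.choose ((a : ℂ) + n - 1) n =
      ∏ i ∈ Finset.range n, ((a : ℂ) + i) := by
    have h2 := Ring.factorial_nsmul_multichoose_eq_ascPochhammer (a : ℂ) n
    rw [Ring.multichoose_eq, nsmul_eq_mul] at h2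
    rw [h2, Polynomial.ascPochhammer_smeval_eq_eval]
    clear h2
    induction n with
    | zero => simp
    | succ n ih => rw [ascPochhammer_succ_eval, Finset.prod_range_succ, ih]
  have h3 : (n.factorial : ℂ) ≠ 0 := by exact_mod_cast n.factorial_ne_zero
  simp only [FormalMultilinearSeries.ofScalars_apply_eq, smul_eq_mul]
  congr 1
  push_cast
  rw [← h1]
  field_simp

theorem hasSum_fiber {R : Type*} [AddCommMonoid R] [TopologicalSpace R] (f : (Fin d → ℕ) → R)
    (n : ℕ) : HasSum (fun α : {α : Fin d → ℕ // ∑ j, α j = n} => f α)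
      (∑ α ∈ Finset.univ.piAntidiag n, f α) := by
  have h := (Finset.univ.piAntidiag n : Finset (Fin d → ℕ)).hasSum f
  exact (Equiv.hasSum_iff (Equiv.subtypeEquivRight (p := fun α : Fin d → ℕ => ∑ j, α j = n)
    (q := fun α => α ∈ Finset.univ.piAntidiag n) fun α => by simp)).2 h

theorem sum_piAntidiag_kappaCoeff {K : Type*} [RCLike K] (a : ℝ) (x : Fin d → K) (n : ℕ) :
    ∑ α ∈ Finset.univ.piAntidiag n, (kappaCoeff a 0 α : K) * ∏ j, x j ^ α j =
      (((∏ i ∈ Finset.range n, (a + i)) / (n.factorial : ℝ) : ℝ) : K) * (∑ j, x j) ^ n := by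
  rw [Finset.sum_pow_eq_sum_piAntidiag, Finset.mul_sum]
  refine Finset.sum_congr rfl fun α hα => ?_
  have hs : ∑ j, α j = n := by simpa using hα
  have h := Nat.multinomial_spec Finset.univ α
  rw [hs] at h
  rw [kappaCoeff_zero_left, hs, ← mul_assoc]
  congr 1
  have h' : (∏ j, ((α j).factorial : K)) * (Nat.multinomial Finset.univ α : K) = n.factorial := by
    exact_mod_cast h
  have h1 : (n.factorial : K) ≠ 0 := by exact_mod_cast n.factorial_ne_zero
  have h2 : (∏ j, ((α j).factorial : K)) ≠ 0 :=
    Finset.prod_ne_zero_iff.2 fun j _ => by exact_mod_cast (α j).factorial_ne_zero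
  push_cast
  rw [div_mul_eq_mul_div, div_eq_div_iff h2 h1, ← h']
  ring

theorem summable_kappaCoeff_zero {a : ℝ} (ha : 0 < a) {t : Fin d → ℝ} (ht : ∀ j, 0 ≤ t j)
    (hs : ∑ j, t j < 1) : Summable fun α : Fin d → ℕ => kappaCoeff a 0 α * ∏ j, t j ^ α j := by
  rw [← (Equiv.sigmaFiberEquiv fun α : Fin d → ℕ => ∑ j, α j).summable_iff]
  have hf := fun n : ℕ => hasSum_fiber (fun α : Fin d → ℕ => kappaCoeff a 0 α * ∏ j, t j ^ α j) n
  refine (summable_sigma_of_nonneg fun p => ?_).2 ⟨fun n => (hf n).summable, ?_⟩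
  · exact mul_nonneg (kappaCoeff_pos ha _ _).le
      (Finset.prod_nonneg fun j _ => pow_nonneg (ht j) _)
  · have hx : ‖((∑ j, t j : ℝ) : ℂ)‖ < 1 := by
      rw [Complex.norm_real, Real.norm_of_nonneg (Finset.sum_nonneg fun j _ => ht j)]
      exact hs
    have h := (hasSum_binomial a hx).summable.norm
    refine h.congr fun n => ?_
    refine Eq.trans ?_ (hf n).tsum_eq.symm
    have := sum_piAntidiag_kappaCoeff (K := ℝ) a t n
    simp only [RCLike.ofReal_real_eq_id, id] at this
    rw [this, norm_mul, norm_pow, Complex.norm_real, Complex.norm_real,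
      Real.norm_of_nonneg (Finset.sum_nonneg fun j _ => ht j),
      Real.norm_of_nonneg (div_nonneg (Finset.prod_nonneg fun i _ => by positivity)
        (by positivity))]

theorem summable_kappaCoeff {a : ℝ} (ha : 0 < a) (β : Fin d → ℕ) {t : Fin d → ℝ}
    (ht : ∀ j, 0 ≤ t j) (hs : ∑ j, t j < 1) :
    Summable fun α : Fin d → ℕ => kappaCoeff a β α * ∏ j, t j ^ α j := by
  have h := summable_kappaCoeff_zero (a := (∑ j, β j : ℕ) + a) (by positivity) ht hs
  refine Summable.of_nonneg_of_le (fun α => ?_) (fun α => ?_) h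
  · exact mul_nonneg (kappaCoeff_pos ha _ _).le
      (Finset.prod_nonneg fun j _ => pow_nonneg (ht j) _)
  · exact mul_le_mul_of_nonneg_right (kappaCoeff_le ha β α)
      (Finset.prod_nonneg fun j _ => pow_nonneg (ht j) _)

theorem hasSum_kappaCoeff_zero {a : ℝ} (ha : 0 < a) {x : Fin d → ℂ} (hs : ∑ j, ‖x j‖ < 1) :
    HasSum (fun α : Fin d → ℕ => (kappaCoeff a 0 α : ℂ) * ∏ j, x j ^ α j)
      ((1 - ∑ j, x j) ^ (-(a : ℂ))) := by
  have hsum : Summable fun α : Fin d → ℕ => (kappaCoeff a 0 α : ℂ) * ∏ j, x j ^ α j := by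
    refine Summable.of_norm ((summable_kappaCoeff_zero ha (fun j => norm_nonneg (x j)) hs).congr
      fun α => ?_)
    simp [abs_of_pos (kappaCoeff_pos ha 0 α)]
  rw [← (Equiv.sigmaFiberEquiv fun α : Fin d → ℕ => ∑ j, α j).hasSum_iff]
  rw [← (Equiv.sigmaFiberEquiv fun α : Fin d → ℕ => ∑ j, α j).summable_iff] at hsum
  refine HasSum.sigma_of_hasSum (hasSum_binomial a ((norm_sum_le _ _).trans_lt hs))
    (fun n => ?_) hsum
  refine Eq.subst (motive := HasSum _) (sum_piAntidiag_kappaCoeff (K := ℂ) a x n) ?_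
  exact hasSum_fiber (fun α : Fin d → ℕ => (kappaCoeff a 0 α : ℂ) * ∏ j, x j ^ α j) n

theorem sum_norm_sq_lt_one {z : EuclideanSpace ℂ (Fin d)} (hz : z ∈ Metric.ball 0 1) :
    ∑ j, ‖z j‖ ^ 2 < 1 := by
  rw [mem_ball_zero_iff] at hz
  rw [← EuclideanSpace.norm_sq_eq]
  nlinarith [norm_nonneg z]

theorem summable_prod_pow {s : ℝ} (h0 : 0 ≤ s) (h1 : s < 1) :
    ∀ d : ℕ, Summable fun α : Fin d → ℕ => ∏ j, s ^ α j
  | 0 => Summable.of_finite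
  | d + 1 => by
    rw [← (Fin.consEquiv fun _ => ℕ).summable_iff]
    refine ((summable_geometric_of_lt_one h0 h1).mul_of_nonneg (summable_prod_pow h0 h1 d)
      (fun n => pow_nonneg h0 n) fun α => Finset.prod_nonneg fun j _ => pow_nonneg h0 _).congr
      fun p => ?_
    simp [Fin.consEquiv, Fin.prod_univ_succ]

/-- Replacing the coefficients by their square roots, at the cost of squaring the variables in
the domain of convergence: shrink the ball slightly and use `xy ≤ x² + y²`. -/
theorem summable_sqrt_kappaCoeff {a : ℝ} (ha : 0 < a) (β : Fin d → ℕ) {t : Fin d → ℝ}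
    (ht : ∀ j, 0 ≤ t j) (hs : ∑ j, t j ^ 2 < 1) :
    Summable fun α : Fin d → ℕ => √(kappaCoeff a β α) * ∏ j, t j ^ α j := by
  obtain ⟨s, hs1, hs2⟩ := exists_between hs
  have hs0 : 0 < s := (Finset.sum_nonneg fun j _ => sq_nonneg (t j)).trans_lt hs1
  have h1 := summable_kappaCoeff ha β (t := fun j => t j ^ 2 / s)
    (fun j => by positivity) (by rw [← Finset.sum_div, div_lt_one hs0]; exact hs1)
  refine Summable.of_nonneg_of_le (fun α => ?_) (fun α => ?_)
    ((summable_prod_pow hs0.le hs2 d).add h1)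
  · exact mul_nonneg (Real.sqrt_nonneg _) (Finset.prod_nonneg fun j _ => pow_nonneg (ht j) _)
  · set x := ∏ j, √s ^ α j
    set y := √(kappaCoeff a β α) * ∏ j, (t j / √s) ^ α j
    have hx : ∏ j, s ^ α j = x ^ 2 := by
      rw [← Finset.prod_pow]
      exact Finset.prod_congr rfl fun j _ => by rw [pow_right_comm, Real.sq_sqrt hs0.le]
    have hy : kappaCoeff a β α * ∏ j, (t j ^ 2 / s) ^ α j = y ^ 2 := by
      rw [mul_pow, Real.sq_sqrt (kappaCoeff_pos ha β α).le, ← Finset.prod_pow]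
      congr 1
      exact Finset.prod_congr rfl fun j _ => by
        rw [pow_right_comm, div_pow _ _ 2, Real.sq_sqrt hs0.le]
    have hxy : √(kappaCoeff a β α) * ∏ j, t j ^ α j = x * y := by
      have : ∏ j, t j ^ α j = x * ∏ j, (t j / √s) ^ α j := by
        rw [← Finset.prod_mul_distrib]
        refine Finset.prod_congr rfl fun j _ => ?_
        rw [← mul_pow, mul_div_cancel₀ _ (Real.sqrt_pos.2 hs0).ne']
      rw [this]
      ring
    rw [hx, hy, hxy]
    nlinarith [sq_nonneg (x - y), sq_nonneg (x + y)]

/-! ### Power series in several variables -/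

/-- A power series that converges absolutely on the ball is holomorphic there. -/
theorem differentiableOn_tsum_monomial {b : (Fin d → ℕ) → ℂ}
    (hb : ∀ t : Fin d → ℝ, (∀ j, 0 ≤ t j) → ∑ j, t j ^ 2 < 1 →
      Summable fun α => ‖b α‖ * ∏ j, t j ^ α j) :
    DifferentiableOn ℂ (fun z : EuclideanSpace ℂ (Fin d) => ∑' α, b α * ∏ j, z j ^ α j)
      (Metric.ball 0 1) := by
  intro z₀ hz₀
  refine DifferentiableAt.differentiableWithinAt ?_
  -- bound the derivatives near `z₀` by the series at the radii `‖z₀ j‖ + 2δ`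
  obtain ⟨δ, hδ, hsum⟩ : ∃ δ : ℝ, 0 < δ ∧ ∑ j, (‖z₀ j‖ + δ + δ) ^ 2 < 1 := by
    have hc : Continuous fun δ : ℝ => ∑ j, (‖z₀ j‖ + δ + δ) ^ 2 := by fun_prop
    have h0 : (∑ j, (‖z₀ j‖ + 0 + 0) ^ 2) < 1 := by simpa using sum_norm_sq_lt_one hz₀
    have h := (hc.tendsto 0).eventually (gt_mem_nhds h0)
    exact ((h.filter_mono (nhdsWithin_le_nhds (s := Set.Ioi 0))).and
      self_mem_nhdsWithin).exists.imp fun δ h => ⟨h.2, h.1⟩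
  have hle : ∀ z ∈ Metric.ball z₀ δ, ∀ j, ‖z j‖ ≤ ‖z₀ j‖ + δ := by
    intro z hz j
    rw [mem_ball_iff_norm] at hz
    have h1 := (PiLp.norm_apply_le (z - z₀) j).trans hz.le
    have h2 := norm_le_norm_add_norm_sub' (z j) (z₀ j)
    simp only [PiLp.sub_apply] at h1
    linarith
  have hder : ∀ (α : Fin d → ℕ) (z : EuclideanSpace ℂ (Fin d)),
      HasFDerivAt (fun z : EuclideanSpace ℂ (Fin d) => b α * ∏ j, z j ^ α j)
        (b α • ∑ i, (∏ j ∈ Finset.univ.erase i, z j ^ α j) •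
          ((α i : ℂ) * z i ^ (α i - 1)) • (EuclideanSpace.proj i : _ →L[ℂ] ℂ)) z := by
    intro α z
    refine HasFDerivAt.const_mul (HasFDerivAt.finsetProd fun i _ => ?_) _
    have h := (EuclideanSpace.proj i : EuclideanSpace ℂ (Fin d) →L[ℂ] ℂ).hasFDerivAt (x := z)
    simpa using h.pow (α i)
  -- Bernoulli's inequality absorbs the factor `n` that differentiation produces
  have hpow : ∀ (n : ℕ) (ρ : ℝ), 0 ≤ ρ → (n : ℝ) * ρ ^ (n - 1) ≤ (ρ + δ) ^ n / δ := by
    intro n ρ hρ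
    rw [le_div_iff₀ hδ]
    refine le_trans ?_ (pow_add_mul_le_add_pow hρ (by positivity) n)
    have := pow_nonneg hρ n
    linarith
  have hu := (hb (fun j => ‖z₀ j‖ + δ + δ) (fun j => by positivity) hsum).mul_right (d / δ)
  refine (hasFDerivAt_tsum_of_isPreconnected hu Metric.isOpen_ball
    (convex_ball z₀ δ).isPreconnected (fun α z _ => hder α z) (fun α z hz => ?_)
    (Metric.mem_ball_self hδ) ?_ (Metric.mem_ball_self hδ)).differentiableAt
  · rw [norm_smul, mul_assoc]
    refine mul_le_mul_of_nonneg_left ?_ (norm_nonneg _)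
    have : ∀ i ∈ Finset.univ, ‖(∏ j ∈ Finset.univ.erase i, z j ^ α j) •
          ((α i : ℂ) * z i ^ (α i - 1)) • (EuclideanSpace.proj i : _ →L[ℂ] ℂ)‖ ≤
        (∏ j, (‖z₀ j‖ + δ + δ) ^ α j) / δ := by
      intro i _
      have hp : ‖(EuclideanSpace.proj i : EuclideanSpace ℂ (Fin d) →L[ℂ] ℂ)‖ ≤ 1 :=
        ContinuousLinearMap.opNorm_le_bound _ zero_le_one fun x => by
          simpa using PiLp.norm_apply_le x i
      rw [norm_smul, norm_smul, norm_prod, norm_mul, norm_pow, Complex.norm_natCast,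
        ← Finset.mul_prod_erase _ _ (Finset.mem_univ i), mul_comm, mul_div_right_comm]
      refine mul_le_mul ?_ ?_ (Finset.prod_nonneg fun j _ => by positivity) (by positivity)
      · refine (mul_le_of_le_one_right (by positivity) hp).trans
          (le_trans ?_ (hpow (α i) (‖z₀ i‖ + δ) (by positivity)))
        gcongr
        exact hle z hz i
      · refine Finset.prod_le_prod (fun j _ => by positivity) fun j _ => ?_
        rw [norm_pow]
        gcongr
        exact (hle z hz j).trans (by linarith)
    refine (norm_sum_le_of_le _ this).trans (le_of_eq ?_)
    simp
    ring
  · refine Summable.of_norm ((hb (fun j => ‖z₀ j‖) (fun j => norm_nonneg _)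
      (sum_norm_sq_lt_one hz₀)).congr fun α => ?_)
    simp

theorem powerSeries_coeff_eq_zero {g : ℕ → ℂ} {r : ℝ} (hr : 0 < r)
    (h : ∀ x : ℂ, ‖x‖ < r → HasSum (fun n => g n * x ^ n) 0) : g = 0 := by
  have hp : HasFPowerSeriesAt (0 : ℂ → ℂ) (FormalMultilinearSeries.ofScalars ℂ g) 0 := by
    rw [hasFPowerSeriesAt_iff]
    filter_upwards [Metric.ball_mem_nhds (0 : ℂ) hr] with x hx
    rw [mem_ball_zero_iff] at hx
    simpa [mul_comm] using h x hx
  funext n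
  have := congrArg (fun p => FormalMultilinearSeries.coeff p n) hp.eq_zero
  rwa [FormalMultilinearSeries.coeff_ofScalars] at this

/-- Uniqueness of the coefficients of a power series in several variables. -/
theorem powerSeries_coeff_eq_zero_of_polydisc {r : ℝ} (hr : 0 < r) {b : (Fin d → ℕ) → ℂ}
    (h : ∀ z : Fin d → ℂ, (∀ j, ‖z j‖ < r) → HasSum (fun α => b α * ∏ j, z j ^ α j) 0) :
    b = 0 := by
  induction d with
  | zero =>
    have := (h 0 fun j => j.elim0).unique (hasSum_fintype _)
    funext α
    have h0 : ∑ α, b α = 0 := by simpa using this.symm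
    rw [Fintype.sum_unique] at h0
    rwa [Subsingleton.elim α]
  | succ d ih =>
    have hz : ∀ z : Fin d → ℂ, (∀ j, ‖z j‖ < r) → ∀ x : ℂ, ‖x‖ < r →
        HasSum (fun p : ℕ × (Fin d → ℕ) =>
          x ^ p.1 * (b (Fin.cons p.1 p.2) * ∏ j, z j ^ p.2 j)) 0 := by
      intro z hz x hx
      have h1 := h (Fin.cons x z)
        (fun j => by refine Fin.cases ?_ (fun i => ?_) j <;> simp [hx, hz])
      rw [← (Fin.consEquiv fun _ => ℕ).hasSum_iff] at h1
      refine h1.congr_fun fun p => ?_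
      simp [Fin.consEquiv, Fin.prod_univ_succ]
      ring
    have hfac : ∀ z : Fin d → ℂ, (∀ j, ‖z j‖ < r) → ∀ n,
        Summable fun α : Fin d → ℕ => b (Fin.cons n α) * ∏ j, z j ^ α j := by
      intro z hzr n
      have hx : ‖((r / 2 : ℝ) : ℂ)‖ < r := by
        rw [Complex.norm_real, Real.norm_of_nonneg (by positivity)]; linarith
      have h0 : ((r / 2 : ℝ) : ℂ) ^ n ≠ 0 :=
        pow_ne_zero n (Complex.ofReal_ne_zero.2 (half_pos hr).ne')
      exact (summable_mul_left_iff h0).1 ((hz z hzr _ hx).summable.prod_factor n)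
    have key : ∀ n : ℕ, (fun α : Fin d → ℕ => b (Fin.cons n α)) = 0 := by
      have hg : ∀ z : Fin d → ℂ, (∀ j, ‖z j‖ < r) →
          (fun n => ∑' α : Fin d → ℕ, b (Fin.cons n α) * ∏ j, z j ^ α j) = 0 := by
        intro z hzr
        refine powerSeries_coeff_eq_zero hr fun x hx => ?_
        have h1 := (hz z hzr x hx).prod_fiberwise fun n => ((hfac z hzr n).hasSum.mul_left (x ^ n))
        exact h1.congr_fun fun n => mul_comm _ _
      intro n
      refine ih fun z hzr => ?_
      have h1 := (hfac z hzr n).hasSum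
      rwa [congrFun (hg z hzr) n] at h1
    funext α
    rw [← Fin.cons_self_tail α]
    exact congrFun (key (α 0)) (Fin.tail α)

end TreeProduct

/-! ### Depth and branching in a rooted tree -/

namespace DirTree

variable {V : Type*} (T : DirTree V)

theorem exists_mem_gen (v : V) : ∃ n, v ∈ T.gen n := by
  induction T.connected T.root v with
  | refl => exact ⟨0, rfl⟩
  | @tail x y _ hxy ih =>
    obtain ⟨n, hn⟩ := ih
    rcases hxy with h | h
    · exact ⟨n + 1, x, hn, h⟩
    · cases n with
      | zero => exact absurd hn (T.ne_root_of_adj h)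
      | succ n =>
        obtain ⟨x', hx', h'⟩ := hn
        rw [← T.parent_eq h, T.parent_eq h']
        exact ⟨n, hx'⟩

theorem eq_of_mem_gen {n m : ℕ} {v : V} (hn : v ∈ T.gen n) (hm : v ∈ T.gen m) : n = m := by
  induction n generalizing m v with
  | zero =>
    cases m with
    | zero => rfl
    | succ m =>
      obtain ⟨x, -, h⟩ := hm
      exact absurd hn (T.ne_root_of_adj h)
  | succ n ih =>
    obtain ⟨x, hx, h⟩ := hn
    cases m with
    | zero => exact absurd hm (T.ne_root_of_adj h)
    | succ m =>
      obtain ⟨y, hy, h'⟩ := hm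
      rw [← T.parent_eq h', T.parent_eq h] at hy
      rw [ih hx hy]

theorem mem_gen_depth (v : V) : v ∈ T.gen (T.depth v) := Nat.sInf_mem (T.exists_mem_gen v)

theorem depth_eq {n : ℕ} {v : V} (h : v ∈ T.gen n) : T.depth v = n :=
  T.eq_of_mem_gen (T.mem_gen_depth v) h

@[simp] theorem depth_root : T.depth T.root = 0 := T.depth_eq rfl

theorem depth_of_adj {v w : V} (h : T.Adj v w) : T.depth w = T.depth v + 1 :=
  T.depth_eq ⟨v, T.mem_gen_depth v, h⟩

theorem depth_parent {v : V} (h : v ≠ T.root) : T.depth v = T.depth (T.parent v) + 1 :=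
  T.depth_of_adj (T.adj_parent h)

theorem chi_nonempty (v : V) : (T.chi v).Nonempty :=
  (T.leafless v).imp fun _ h => T.mem_chi.2 h

theorem finite_gen (n : ℕ) : (T.gen n).Finite := by
  induction n with
  | zero => exact Set.finite_singleton _
  | succ n ih =>
    refine (ih.biUnion fun v _ => T.locallyFinite v).subset ?_
    rintro w ⟨v, hv, h⟩
    exact Set.mem_biUnion hv h

theorem finite_branching (h : T.branchingIndex ≠ ⊤) : T.branching.Finite := by
  by_cases hb : T.branching.Nonempty
  · rw [branchingIndex, if_pos hb] at h
    have h1 : (⨆ w ∈ T.branching, (T.depth w : ℕ∞)) ≠ ⊤ := fun h' => h (by simp [h'])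
    obtain ⟨N, hN⟩ := ENat.ne_top_iff_exists.1 h1
    refine ((Set.finite_Iic N).biUnion fun n _ => T.finite_gen n).subset fun w hw => ?_
    refine Set.mem_biUnion (x := T.depth w) ?_ (T.mem_gen_depth w)
    have h2 : (T.depth w : ℕ∞) ≤ N := by
      rw [hN]
      exact le_iSup₂ (f := fun w (_ : w ∈ T.branching) => (T.depth w : ℕ∞)) w hw
    exact_mod_cast h2
  · rw [Set.not_nonempty_iff_eq_empty.1 hb]
    exact Set.finite_empty

theorem mem_sib {v w : V} : w ∈ T.sib v ↔ v ≠ T.root ∧ w ≠ T.root ∧ T.parent w = T.parent v := by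
  constructor
  · rintro ⟨h1, h2⟩
    rw [T.mem_chi] at h2
    exact ⟨h1, T.ne_root_of_adj h2, T.parent_eq h2⟩
  · rintro ⟨h1, h2, h3⟩
    exact ⟨h1, by rw [T.mem_chi, ← h3]; exact T.adj_parent h2⟩

end DirTree

namespace TreeProduct

variable {d : ℕ} {V : Fin d → Type*} (T : ∀ j, DirTree (V j))

/-- The vertices all of whose coordinates are roots or children of branching vertices. -/
def branchingSupport : Set (∀ j, V j) :=
  {v | ∀ j, v j ≠ (T j).root → (T j).parent (v j) ∈ (T j).branching}

theorem finite_branchingSupport (hT : ∑ j, (T j).branchingIndex ≠ ⊤) :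
    (branchingSupport T).Finite := by
  have hj : ∀ j, (T j).branchingIndex ≠ ⊤ := fun j h =>
    hT (top_unique (h ▸ Finset.single_le_sum (f := fun j => (T j).branchingIndex)
      (fun _ _ => zero_le) (Finset.mem_univ j)))
  refine (Set.Finite.pi' fun j => (((T j).finite_branching (hj j)).biUnion
    fun b _ => (T j).locallyFinite b).insert (T j).root).subset fun v hv j => ?_
  by_cases h : v j = (T j).root
  · exact Or.inl h
  · exact Or.inr (Set.mem_biUnion (hv j h) ((T j).adj_parent h))

/-! ### Depth in the product -/

theorem depth_root : depth T (root T) = 0 := funext fun j => (T j).depth_root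

theorem depth_of_mem_chi {j : Fin d} {v w : ∀ j, V j} (h : w ∈ chi T j v) :
    depth T w = depth T v + Pi.single j 1 := by
  rw [mem_chi_iff] at h
  funext k
  by_cases hk : k = j
  · subst hk; simpa [depth] using (T k).depth_of_adj h.1
  · simp [depth, hk, h.2 k hk]

theorem depth_par {j : Fin d} {v : ∀ j, V j} (h : v j ≠ (T j).root) :
    depth T v = depth T (par T j v) + Pi.single j 1 := depth_of_mem_chi T (mem_chi_par T h)

theorem ne_root_of_mem_chi {j : Fin d} {v w : ∀ j, V j} (h : w ∈ chi T j v) :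
    w j ≠ (T j).root := (T j).ne_root_of_adj ((mem_chi_iff T).1 h).1

theorem card_chi (j : Fin d) (v : ∀ j, V j) : (chi T j v).card = ((T j).chi (v j)).card := by
  simp [chi]

theorem chi_nonempty (j : Fin d) (v : ∀ j, V j) : (chi T j v).Nonempty := by
  simpa [chi] using (T j).chi_nonempty (v j)

/-- The common value of the weights `λ^{(j)}_w` over `w ∈ Chi_j(v)`. -/
def chiWeight (a : ℝ) (j : Fin d) (v : ∀ j, V j) : ℝ :=
  √(1 / ((chi T j v).card : ℝ)) * √(((depth T v j : ℝ) + 1) / ((absDepth T v : ℝ) + a))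

theorem weight_eq {a : ℝ} {j : Fin d} {v w : ∀ j, V j} (h : w ∈ chi T j v) :
    weight T a j w = chiWeight T a j v := by
  rw [weight, par_eq_of_mem_chi T h, chiWeight]

theorem chiWeight_pos {a : ℝ} (ha : 0 < a) (j : Fin d) (v : ∀ j, V j) : 0 < chiWeight T a j v := by
  have := (chi_nonempty T j v).card_pos
  have h : (0 : ℝ) < (chi T j v).card := by exact_mod_cast this
  unfold chiWeight
  positivity

theorem card_mul_chiWeight_sq {a : ℝ} (ha : 0 < a) (j : Fin d) (v : ∀ j, V j) :
    ((chi T j v).card : ℝ) * chiWeight T a j v ^ 2 =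
      ((depth T v j : ℝ) + 1) / ((absDepth T v : ℝ) + a) := by
  have h : (0 : ℝ) < (chi T j v).card := by exact_mod_cast (chi_nonempty T j v).card_pos
  rw [chiWeight, mul_pow, Real.sq_sqrt (by positivity), Real.sq_sqrt (by positivity)]
  field_simp

theorem par_comm (i j : Fin d) (hij : i ≠ j) (v : ∀ j, V j) :
    par T i (par T j v) = par T j (par T i v) := by
  simp only [par, Function.update_of_ne hij, Function.update_of_ne hij.symm]
  exact (Function.update_comm hij _ _ _).symm

/-- For `i ≠ j` taking the parent in direction `j` is a bijection from the children of `v` in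
direction `i` to the children of `par_j(v)` in direction `i`. -/
theorem sum_chi_par {M : Type*} [AddCommMonoid M] {i j : Fin d} (hij : i ≠ j) (v : ∀ j, V j)
    (g : (∀ j, V j) → M) :
    ∑ w ∈ chi T i v, g (par T j w) = ∑ w ∈ chi T i (par T j v), g w := by
  simp only [chi, Finset.sum_map, Function.Embedding.coeFn_mk, par, Function.update_of_ne hij,
    Function.update_of_ne hij.symm]
  exact Finset.sum_congr rfl fun x _ => by rw [Function.update_comm hij]

/-! ### The shifts and their adjoints -/

theorem chiWeight_of_mem_chi (a : ℝ) {i j : Fin d} (hij : i ≠ j) {v w : ∀ j, V j}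
    (h : w ∈ chi T i v) : chiWeight T a j w = √(1 / ((chi T j v).card : ℝ)) *
      √(((depth T v j : ℝ) + 1) / ((absDepth T v : ℝ) + 1 + a)) := by
  have h1 : w j = v j := ((mem_chi_iff T).1 h).2 j hij.symm
  have h2 : absDepth T w = absDepth T v + 1 := by
    simp [absDepth, depth_of_mem_chi T h, Finset.sum_add_distrib]
  have h3 : depth T w j = depth T v j := by simp [depth, h1]
  rw [chiWeight, card_chi, card_chi, h1, h2, h3]
  push_cast
  rfl

theorem shift_apply_of_mem_chi {a : ℝ} (ha : 0 < a) {j : Fin d} {v w : ∀ j, V j}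
    (h : w ∈ chi T j v) (f : L2 V) : shift T a ha j f w = (chiWeight T a j v : ℂ) * f v := by
  rw [shift_apply, shiftFun, if_neg (ne_root_of_mem_chi T h), weight_eq T h,
    par_eq_of_mem_chi T h]

theorem shift_apply_of_eq_root {a : ℝ} (ha : 0 < a) {j : Fin d} {w : ∀ j, V j}
    (h : w j = (T j).root) (f : L2 V) : shift T a ha j f w = 0 := by
  rw [shift_apply, shiftFun, if_pos h]

theorem inner_eq_tsum_mul (f g : L2 V) : inner ℂ f g = ∑' v, conj (f v) * g v := by
  refine (lp.inner_eq_tsum (𝕜 := ℂ) (G := fun _ : (∀ j, V j) => ℂ) f g).trans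
    (tsum_congr fun v => ?_)
  simp [mul_comm]

open Classical in
theorem adjoint_shift_apply {a : ℝ} (ha : 0 < a) (j : Fin d) (f : L2 V) (v : ∀ j, V j) :
    ContinuousLinearMap.adjoint (shift T a ha j) f v =
      (chiWeight T a j v : ℂ) * ∑ w ∈ chi T j v, f w := by
  have h := lp.inner_single_left (𝕜 := ℂ) (G := fun _ : (∀ j, V j) => ℂ) v (1 : ℂ)
    (ContinuousLinearMap.adjoint (shift T a ha j) f)
  rw [ContinuousLinearMap.adjoint_inner_right, inner_eq_tsum_mul] at h
  simp only [RCLike.inner_apply, map_one, mul_one] at h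
  rw [← h, Finset.mul_sum, tsum_eq_sum (s := chi T j v)]
  · refine Finset.sum_congr rfl fun w hw => ?_
    simp [shift_apply_of_mem_chi T ha hw]
  · intro w hw
    by_cases hr : w j = (T j).root
    · simp [shift_apply_of_eq_root T ha hr]
    · have hp : par T j w ≠ v := fun hp => hw (hp ▸ mem_chi_par T hr)
      simp [shift_apply_of_mem_chi T ha (mem_chi_par T hr), hp]

theorem adjoint_shift_eq_zero_iff {a : ℝ} (ha : 0 < a) (j : Fin d) (f : L2 V) :
    ContinuousLinearMap.adjoint (shift T a ha j) f = 0 ↔ ∀ v, ∑ w ∈ chi T j v, f w = 0 := by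
  constructor
  · intro h v
    have h1 := adjoint_shift_apply T ha j f v
    rw [h] at h1
    have h2 : ((chiWeight T a j v : ℝ) : ℂ) ≠ 0 :=
      Complex.ofReal_ne_zero.2 (chiWeight_pos T ha j v).ne'
    simpa [h2] using h1.symm
  · intro h
    ext v
    rw [adjoint_shift_apply, h]
    simp

theorem mem_jointKernel_iff {a : ℝ} (ha : 0 < a) {f : L2 V} :
    f ∈ jointKernel T a ha ↔ ∀ j v, ∑ w ∈ chi T j v, f w = 0 := by
  simp only [jointKernel, Submodule.mem_iInf]
  exact forall_congr' fun j => adjoint_shift_eq_zero_iff T ha j f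

theorem sqrt_div_exchange {x y : ℝ} (hx : 0 ≤ x) (hy : 0 ≤ y) (p q s t : ℝ) :
    s * √(x / p) * (t * √(y / q)) = t * √(y / p) * (s * √(x / q)) := by
  rw [Real.sqrt_div hx, Real.sqrt_div hx, Real.sqrt_div hy, Real.sqrt_div hy]
  ring

theorem shift_comm {a : ℝ} (ha : 0 < a) (i j : Fin d) :
    Commute (shift T a ha i) (shift T a ha j) := by
  by_cases hij : i = j
  · rw [hij]
  ext f w
  simp only [mul_apply_eq_comp]
  by_cases hi : w i = (T i).root
  · rw [shift_apply_of_eq_root T ha hi]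
    by_cases hj : w j = (T j).root
    · rw [shift_apply_of_eq_root T ha hj]
    · rw [shift_apply_of_mem_chi T ha (mem_chi_par T hj), shift_apply_of_eq_root, mul_zero]
      simpa [par, hij] using hi
  · by_cases hj : w j = (T j).root
    · rw [shift_apply_of_eq_root T ha hj, shift_apply_of_mem_chi T ha (mem_chi_par T hi),
        shift_apply_of_eq_root, mul_zero]
      simpa [par, Ne.symm hij] using hj
    · have hij' : par T i w ∈ chi T j (par T j (par T i w)) :=
        mem_chi_par T (by simpa [par, Ne.symm hij] using hj)
      have hji' : par T j w ∈ chi T i (par T j (par T i w)) := by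
        rw [← par_comm T i j hij]
        exact mem_chi_par T (by simpa [par, hij] using hi)
      rw [shift_apply_of_mem_chi T ha (mem_chi_par T hi), shift_apply_of_mem_chi T ha hij',
        shift_apply_of_mem_chi T ha (mem_chi_par T hj), shift_apply_of_mem_chi T ha hji',
        chiWeight_of_mem_chi T a (Ne.symm hij) hij', chiWeight_of_mem_chi T a hij hji',
        ← mul_assoc, ← mul_assoc, ← Complex.ofReal_mul, ← Complex.ofReal_mul, chiWeight, chiWeight]
      congr 2
      exact sqrt_div_exchange (by positivity) (by positivity) _ _ _ _

theorem adjoint_shift_shift_apply {a : ℝ} (ha : 0 < a) (j : Fin d) (f : L2 V) (v : ∀ j, V j) :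
    ContinuousLinearMap.adjoint (shift T a ha j) (shift T a ha j f) v =
      ((((depth T v j : ℝ) + 1) / ((absDepth T v : ℝ) + a) : ℝ) : ℂ) * f v := by
  rw [adjoint_shift_apply, Finset.sum_congr rfl fun w hw => shift_apply_of_mem_chi T ha hw f,
    Finset.sum_const, nsmul_eq_mul, ← card_mul_chiWeight_sq T ha]
  push_cast
  ring

/-- For `i ≠ j` the shift `S_j` leaves the kernel of `S_i^*` invariant, since the weights in
direction `j` are constant on the children in direction `i`. -/
theorem adjoint_shift_shift_eq_zero {a : ℝ} (ha : 0 < a) {i j : Fin d} (hij : i ≠ j) {f : L2 V}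
    (hf : ContinuousLinearMap.adjoint (shift T a ha i) f = 0) :
    ContinuousLinearMap.adjoint (shift T a ha i) (shift T a ha j f) = 0 := by
  rw [adjoint_shift_eq_zero_iff] at hf ⊢
  intro v
  by_cases hj : v j = (T j).root
  · refine Finset.sum_eq_zero fun w hw => shift_apply_of_eq_root T ha ?_ f
    rw [((mem_chi_iff T).1 hw).2 j hij.symm, hj]
  · have hw : ∀ w ∈ chi T i v, shift T a ha j f w =
        ((√(1 / ((chi T j (par T j v)).card : ℝ)) * √(((depth T (par T j v) j : ℝ) + 1) /
          ((absDepth T (par T j v) : ℝ) + 1 + a)) : ℝ) : ℂ) * f (par T j w) := by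
      intro w hw
      have hw' := (mem_chi_iff T).1 hw
      have h1 : w j ≠ (T j).root := by rwa [hw'.2 j hij.symm]
      have h2 : par T j w ∈ chi T i (par T j v) := by
        rw [mem_chi_iff]
        refine ⟨by simpa [par, hij] using hw'.1, fun k hk => ?_⟩
        by_cases hkj : k = j
        · subst hkj; simp [par, hw'.2 k hk]
        · simp [par, hkj, hw'.2 k hk]
      rw [shift_apply_of_mem_chi T ha (mem_chi_par T h1), chiWeight_of_mem_chi T a hij h2]
    rw [Finset.sum_congr rfl hw, ← Finset.mul_sum, sum_chi_par T hij, hf, mul_zero]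

/-! ### Restriction to sets of vertices -/

/-- The restriction of `f` to the set `s` of vertices, extended by zero. -/
def cutoff (s : Set (∀ j, V j)) (f : L2 V) : L2 V :=
  ⟨s.indicator f, (lp.memℓp f).mono' fun v => by
    by_cases h : v ∈ s <;> simp [h]⟩

theorem cutoff_of_mem {s : Set (∀ j, V j)} (f : L2 V) {v : ∀ j, V j} (h : v ∈ s) :
    cutoff s f v = f v := Set.indicator_of_mem h f

theorem cutoff_of_notMem {s : Set (∀ j, V j)} (f : L2 V) {v : ∀ j, V j} (h : v ∉ s) :
    cutoff s f v = 0 := Set.indicator_of_notMem h f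

/-- If `y` vanishes off `s`, then only the part of `f` on `s` contributes to `⟪y, f⟫`. -/
theorem inner_cutoff_right {s : Set (∀ j, V j)} {y : L2 V} (hy : ∀ v, v ∉ s → y v = 0) (f : L2 V) :
    inner ℂ y (cutoff s f) = inner ℂ y f := by
  rw [inner_eq_tsum_mul, inner_eq_tsum_mul]
  refine tsum_congr fun v => ?_
  by_cases h : v ∈ s
  · rw [cutoff_of_mem f h]
  · simp [hy v h]

/-! ### Grading by depth and the joint kernel -/

/-- The vertices of depth `β`. -/
def level (β : Fin d → ℕ) : Set (∀ j, V j) := {v | depth T v = β}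

/-- `f` is homogeneous of degree `β` if it vanishes at all vertices of depth different
from `β`. -/
def IsHomogeneous (β : Fin d → ℕ) (f : L2 V) : Prop := ∀ v, v ∉ level T β → f v = 0

theorem isHomogeneous_cutoff (β : Fin d → ℕ) (f : L2 V) :
    IsHomogeneous T β (cutoff (level T β) f) := fun _ h => cutoff_of_notMem f h

theorem isHomogeneous_shift {a : ℝ} (ha : 0 < a) (j : Fin d) {β : Fin d → ℕ} {f : L2 V}
    (hf : IsHomogeneous T β f) : IsHomogeneous T (β + Pi.single j 1) (shift T a ha j f) := by
  intro v hv
  by_cases hr : v j = (T j).root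
  · exact shift_apply_of_eq_root T ha hr f
  · rw [shift_apply_of_mem_chi T ha (mem_chi_par T hr), hf _ fun h => hv ?_, mul_zero]
    rw [level, Set.mem_ofPred_eq, depth_par T hr, h]

theorem adjoint_shift_shift_of_isHomogeneous {a : ℝ} (ha : 0 < a) (j : Fin d) {β : Fin d → ℕ}
    {f : L2 V} (hf : IsHomogeneous T β f) :
    ContinuousLinearMap.adjoint (shift T a ha j) (shift T a ha j f) =
      ((((β j : ℝ) + 1) / (((∑ k, β k : ℕ) : ℝ) + a) : ℝ) : ℂ) • f := by
  ext v
  rw [adjoint_shift_shift_apply, lp.coeFn_smul, Pi.smul_apply, smul_eq_mul]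
  by_cases h : depth T v = β
  · rw [absDepth, h]
  · rw [hf v h, mul_zero, mul_zero]

theorem cutoff_level_mem_jointKernel {a : ℝ} (ha : 0 < a) (β : Fin d → ℕ) {f : L2 V}
    (hf : f ∈ jointKernel T a ha) : cutoff (level T β) f ∈ jointKernel T a ha := by
  rw [mem_jointKernel_iff] at hf ⊢
  intro j v
  by_cases h : depth T v + Pi.single j 1 = β
  · rw [← hf j v]
    exact Finset.sum_congr rfl fun w hw => cutoff_of_mem f ((depth_of_mem_chi T hw).trans h)
  · exact Finset.sum_eq_zero fun w hw =>
      cutoff_of_notMem f fun hw' => h ((depth_of_mem_chi T hw).symm.trans hw')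

/-- Functions in the joint kernel live on the children of branching vertices: a function that
sums to zero over the children of a vertex vanishes at an only child. -/
theorem mem_branchingSupport_of_mem_jointKernel {a : ℝ} (ha : 0 < a) {f : L2 V}
    (hf : f ∈ jointKernel T a ha) {v : ∀ j, V j} (hv : f v ≠ 0) : v ∈ branchingSupport T := by
  rw [mem_jointKernel_iff] at hf
  intro j hj
  by_contra hb
  have hmem := mem_chi_par T hj
  have hcard : (chi T j (par T j v)).card ≤ 1 := by
    rw [card_chi]
    simp only [DirTree.branching, Set.mem_ofPred_eq, not_le] at hb
    simpa [par] using Nat.le_of_lt_succ hb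
  have hsum := hf j (par T j v)
  rw [Finset.sum_eq_single_of_mem v hmem fun w hw hwv =>
    absurd (Finset.card_le_one.1 hcard w hw v hmem) hwv] at hsum
  exact hv hsum

/-! ### The solution spaces -/

theorem mem_sibF_comm {F : Finset (Fin d)} {u v : ∀ j, V j} (h : v ∈ sibF T F u) :
    u ∈ sibF T F v := by
  refine ⟨fun j hj => ?_, fun j hj => (h.2 j hj).symm⟩
  have := (T j).mem_sib.1 (h.1 j hj)
  exact (T j).mem_sib.2 ⟨this.2.1, this.1, this.2.2.symm⟩

theorem depth_of_mem_sibF {F : Finset (Fin d)} {u v : ∀ j, V j} (h : v ∈ sibF T F u) :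
    depth T v = depth T u := by
  funext j
  by_cases hj : j ∈ F
  · obtain ⟨h1, h2, h3⟩ := (T j).mem_sib.1 (h.1 j hj)
    rw [depth, depth, (T j).depth_parent h1, (T j).depth_parent h2, h3]
  · rw [depth, depth, h.2 j hj]

theorem mem_Phi_of_mem_sibF {F : Finset (Fin d)} {u v : ∀ j, V j} (hu : u ∈ Phi T F)
    (h : v ∈ sibF T F u) : v ∈ Phi T F := by
  intro j
  by_cases hj : j ∈ F
  · simpa [hj] using ((T j).mem_sib.1 (h.1 j hj)).2.1
  · rw [h.2 j hj]
    exact hu j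

theorem sib_update_restrictTo {F : Finset (Fin d)} {u v : ∀ j, V j} (hu : u ∈ Phi T F)
    (hv : v ∈ sibF T F u) {i : Fin d} (hi : i ∈ F) :
    sib T i (Function.update (restrictTo T (F.erase i) v) i (u i)) = chi T i (par T i v) := by
  have hui : u i ≠ (T i).root := (hu i).2 hi
  rw [sib, if_neg (by simpa using hui)]
  congr 1
  funext k
  by_cases hk : k = i
  · subst hk
    simpa [par] using ((T k).mem_sib.1 (hv.1 k hi)).2.2.symm
  · by_cases hkF : k ∈ F
    · simp [par, hk, restrictTo, hkF]
    · have : v k = (T k).root := by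
        rw [hv.2 k hkF]
        by_contra h
        exact hkF ((hu k).1 h)
      simp [par, hk, restrictTo, hkF, this]

theorem mem_solutionSpace_iff {a : ℝ} (ha : 0 < a) {F : Finset (Fin d)} {u : ∀ j, V j}
    (hu : u ∈ Phi T F) {f : L2 V} : f ∈ solutionSpace T a u F ↔
      (∀ w, w ∉ sibF T F u → f w = 0) ∧
        ∀ i ∈ F, ∀ v ∈ sibF T F u, ∑ w ∈ chi T i (par T i v), f w = 0 := by
  refine and_congr_right fun _ => forall₂_congr fun i hi => forall₂_congr fun v hv => ?_
  rw [sib_update_restrictTo T hu hv hi,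
    Finset.sum_congr rfl fun w hw => by rw [weight_eq T hw], ← Finset.sum_mul, mul_eq_zero,
    or_iff_left (Complex.ofReal_ne_zero.2 (chiWeight_pos T ha i _).ne')]

/-- A class `sib_F(u)` contains with a vertex all its siblings in the directions of `F`. -/
theorem mem_sibF_of_mem_chi_par {F : Finset (Fin d)} {u v w : ∀ j, V j} {i : Fin d} (hi : i ∈ F)
    (hv : v ∈ sibF T F u) (hw : w ∈ chi T i (par T i v)) : w ∈ sibF T F u := by
  have hw' := (mem_chi_iff T).1 hw
  have hk : ∀ k, k ≠ i → w k = v k := fun k hk => by simp [hw'.2 k hk, par, hk]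
  refine ⟨fun k hkF => ?_, fun k hkF => ?_⟩
  · by_cases hki : k = i
    · subst hki
      have h := (T k).mem_sib.1 (hv.1 k hkF)
      refine (T k).mem_sib.2 ⟨h.1, ne_root_of_mem_chi T hw, ?_⟩
      rw [(T k).parent_eq hw'.1, ← h.2.2]
      simp [par]
    · rw [hk k hki]
      exact hv.1 k hkF
  · rw [hk k (fun h => hkF (h ▸ hi))]
    exact hv.2 k hkF

theorem solutionSpace_le_jointKernel {a : ℝ} (ha : 0 < a) {F : Finset (Fin d)} {u : ∀ j, V j}
    (hu : u ∈ Phi T F) : solutionSpace T a u F ≤ jointKernel T a ha := by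
  intro f hf
  obtain ⟨h1, h2⟩ := (mem_solutionSpace_iff T ha hu).1 hf
  rw [mem_jointKernel_iff]
  intro i v
  by_cases h : ∃ w ∈ chi T i v, w ∈ sibF T F u
  · obtain ⟨w, hw, hwu⟩ := h
    have hi : i ∈ F := (mem_Phi_of_mem_sibF T hu hwu i).1 (ne_root_of_mem_chi T hw)
    have := h2 i hi w hwu
    rwa [par_eq_of_mem_chi T hw] at this
  · push Not at h
    exact Finset.sum_eq_zero fun w hw => h1 w (h w hw)

theorem cutoff_sibF_mem_solutionSpace {a : ℝ} (ha : 0 < a) {F : Finset (Fin d)} {u : ∀ j, V j}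
    (hu : u ∈ Phi T F) {f : L2 V} (hf : f ∈ jointKernel T a ha) :
    cutoff (sibF T F u) f ∈ solutionSpace T a u F := by
  rw [mem_jointKernel_iff] at hf
  refine (mem_solutionSpace_iff T ha hu).2 ⟨fun w hw => cutoff_of_notMem f hw, fun i hi v hv => ?_⟩
  rw [← hf i (par T i v)]
  exact Finset.sum_congr rfl fun w hw => cutoff_of_mem f (mem_sibF_of_mem_chi_par T hi hv hw)

/-- On the joint kernel the projection onto `L_{u,F}` is the restriction to `sib_F(u)`. -/
theorem starProjection_solutionSpace {a : ℝ} (ha : 0 < a) {F : Finset (Fin d)} {u : ∀ j, V j}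
    (hu : u ∈ Phi T F) {f : L2 V} (hf : f ∈ jointKernel T a ha) :
    (solutionSpace T a u F).starProjection f = cutoff (sibF T F u) f := by
  refine Submodule.eq_starProjection_of_mem_of_inner_eq_zero
    (cutoff_sibF_mem_solutionSpace T ha hu hf) fun g hg => ?_
  rw [← inner_conj_symm, inner_sub_right,
    inner_cutoff_right ((mem_solutionSpace_iff T ha hu).1 hg).1, sub_self, map_zero]

theorem starProjection_rootSpace (f : L2 V) :
    (rootSpace T).starProjection f = cutoff {root T} f := by
  classical
  have hs : cutoff {root T} f = f (root T) • lp.single 2 (root T) (1 : ℂ) := by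
    ext v
    by_cases h : v = root T
    · subst h; simp [cutoff_of_mem]
    · rw [cutoff_of_notMem (s := {root T}) f h]
      simp [h]
  refine Submodule.eq_starProjection_of_mem_of_inner_eq_zero ?_ fun g hg => ?_
  · rw [hs]
    refine Submodule.smul_mem _ _ (Submodule.mem_span_singleton.2 ⟨1, ?_⟩)
    rw [one_smul]
  · obtain ⟨c, rfl⟩ := Submodule.mem_span_singleton.1 hg
    rw [← inner_conj_symm, inner_sub_right, inner_cutoff_right, sub_self, map_zero]
    intro v hv
    simp [Set.mem_singleton_iff.not.1 hv]

/-- A nonzero solution space forces all coordinates in `F` to be children of branching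
vertices. -/
theorem mem_branchingSupport_of_solutionSpace_ne_bot {a : ℝ} (ha : 0 < a) {F : Finset (Fin d)}
    {u : ∀ j, V j} (hu : u ∈ Phi T F) (h : solutionSpace T a u F ≠ ⊥) :
    u ∈ branchingSupport T := by
  obtain ⟨f, hf, hf0⟩ := Submodule.exists_mem_ne_zero_of_ne_bot h
  obtain ⟨v, hv⟩ : ∃ v, f v ≠ 0 := by
    by_contra! hc
    exact hf0 (lp.ext (funext hc))
  have hvu : v ∈ sibF T F u := by
    by_contra hc
    exact hv (((mem_solutionSpace_iff T ha hu).1 hf).1 v hc)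
  have hb := mem_branchingSupport_of_mem_jointKernel T ha
    (solutionSpace_le_jointKernel T ha hu hf) hv
  intro j hj
  have hs := (T j).mem_sib.1 (hvu.1 j ((hu j).1 hj))
  rw [← hs.2.2]
  exact hb j hs.2.1

/-! ### Monomials in the shifts -/

theorem noncommProd_pow_add_single {M : Type*} [Monoid M] (s : Fin d → M)
    (hs : ∀ i j, Commute (s i) (s j)) (α : Fin d → ℕ) (j : Fin d) :
    Finset.univ.noncommProd (fun k => s k ^ (α + Pi.single j 1 : Fin d → ℕ) k)
        (fun i _ k _ _ => (hs i k).pow_pow _ _) =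
      s j * Finset.univ.noncommProd (fun k => s k ^ α k)
        fun i _ k _ _ => (hs i k).pow_pow _ _ := by
  have hc : Pairwise fun i k => ∀ m n : Multiplicative ℕ,
      Commute (powersHom M (s i) m) (powersHom M (s k) n) := fun i k _ m n => by
    simpa using (hs i k).pow_pow m.toAdd n.toAdd
  have h : ∀ α : Fin d → ℕ, Finset.univ.noncommProd (fun k => s k ^ α k)
        (fun i _ k _ _ => (hs i k).pow_pow _ _) =
      MonoidHom.noncommPiCoprod (fun k => powersHom M (s k)) hc
        fun k => Multiplicative.ofAdd (α k) := fun α => by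
    rw [MonoidHom.noncommPiCoprod_apply]
    rfl
  have hα : (fun k => Multiplicative.ofAdd ((α + Pi.single j 1 : Fin d → ℕ) k)) =
      Pi.mulSingle j (Multiplicative.ofAdd 1) * fun k => Multiplicative.ofAdd (α k) := by
    funext k
    by_cases hk : k = j
    · subst hk; simp [mul_comm]
    · simp [hk]
  rw [h, h, hα, map_mul, MonoidHom.noncommPiCoprod_mulSingle]
  simp

/-- The monomial `S^α = S_1^{α_1} ⋯ S_d^{α_d}` in the commuting shifts. -/
def shiftMonomial (a : ℝ) (ha : 0 < a) (α : Fin d → ℕ) : L2 V →L[ℂ] L2 V :=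
  Finset.univ.noncommProd (fun j => shift T a ha j ^ α j)
    fun i _ j _ _ => (shift_comm T ha i j).pow_pow _ _

theorem shiftMonomial_zero {a : ℝ} (ha : 0 < a) : shiftMonomial T a ha 0 = 1 :=
  (Finset.noncommProd_eq_pow_card _ _ _ 1 fun _ _ => pow_zero _).trans (one_pow _)

theorem shiftMonomial_add_single_apply {a : ℝ} (ha : 0 < a) (α : Fin d → ℕ) (j : Fin d)
    (f : L2 V) : shiftMonomial T a ha (α + Pi.single j 1) f =
      shift T a ha j (shiftMonomial T a ha α f) := by
  exact congrArg (fun A : L2 V →L[ℂ] L2 V => A f)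
    (noncommProd_pow_add_single (shift T a ha) (shift_comm T ha) α j)

theorem shiftMonomial_zero_apply {a : ℝ} (ha : 0 < a) (f : L2 V) :
    shiftMonomial T a ha 0 f = f := by
  rw [shiftMonomial_zero]
  rfl

theorem isHomogeneous_shiftMonomial {a : ℝ} (ha : 0 < a) {β : Fin d → ℕ} {f : L2 V}
    (hf : IsHomogeneous T β f) (α : Fin d → ℕ) :
    IsHomogeneous T (β + α) (shiftMonomial T a ha α f) := by
  induction α using multiIndex_induction with
  | zero => rwa [shiftMonomial_zero_apply, add_zero]
  | add_single α j ih =>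
    rw [shiftMonomial_add_single_apply, ← add_assoc]
    exact isHomogeneous_shift T ha j ih

theorem adjoint_shift_shiftMonomial {a : ℝ} (ha : 0 < a) {β : Fin d → ℕ} {f : L2 V}
    (hf : IsHomogeneous T β f) (α : Fin d → ℕ) (j : Fin d) :
    (kappaCoeff a β (α + Pi.single j 1) : ℂ) • ContinuousLinearMap.adjoint (shift T a ha j)
      (shiftMonomial T a ha (α + Pi.single j 1) f) =
      (kappaCoeff a β α : ℂ) • shiftMonomial T a ha α f := by
  rw [shiftMonomial_add_single_apply, adjoint_shift_shift_of_isHomogeneous T ha j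
    (isHomogeneous_shiftMonomial T ha hf α), smul_smul, ← Complex.ofReal_mul]
  congr 2
  rw [← mul_div_assoc, kappaCoeff_add_single]
  exact mul_div_cancel_right₀ _ (by positivity)

theorem adjoint_shift_shiftMonomial_eq_zero {a : ℝ} (ha : 0 < a) {f : L2 V} {j : Fin d}
    (hf : ContinuousLinearMap.adjoint (shift T a ha j) f = 0) {α : Fin d → ℕ} (hα : α j = 0) :
    ContinuousLinearMap.adjoint (shift T a ha j) (shiftMonomial T a ha α f) = 0 := by
  induction α using multiIndex_induction with
  | zero => rwa [shiftMonomial_zero_apply]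
  | add_single α k ih =>
    have hkj : j ≠ k := by
      rintro rfl
      simp at hα
    rw [shiftMonomial_add_single_apply]
    exact adjoint_shift_shift_eq_zero T ha hkj (ih (by simpa [hkj] using hα))

/-- On functions of degree `β` the monomial `S^α` scales the norm by `c(β, α)^{-1/2}`. -/
theorem kappaCoeff_mul_norm_sq {a : ℝ} (ha : 0 < a) {β : Fin d → ℕ} {f : L2 V}
    (hf : IsHomogeneous T β f) (α : Fin d → ℕ) :
    kappaCoeff a β α * ‖shiftMonomial T a ha α f‖ ^ 2 = ‖f‖ ^ 2 := by
  induction α using multiIndex_induction with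
  | zero => rw [shiftMonomial_zero_apply, kappaCoeff_zero_right, one_mul]
  | add_single α j ih =>
    have h := congrArg (inner ℂ (shiftMonomial T a ha α f))
      (adjoint_shift_shiftMonomial T ha hf α j)
    rw [inner_smul_right, inner_smul_right, ContinuousLinearMap.adjoint_inner_right,
      ← shiftMonomial_add_single_apply, inner_self_eq_norm_sq_to_K,
      inner_self_eq_norm_sq_to_K] at h
    rw [← ih]
    have h' := congrArg Complex.re h
    simpa [← Complex.ofReal_pow, ← Complex.ofReal_mul] using h'

theorem kappaCoeff_mul_norm {a : ℝ} (ha : 0 < a) {β : Fin d → ℕ} {f : L2 V}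
    (hf : IsHomogeneous T β f) (α : Fin d → ℕ) :
    kappaCoeff a β α * ‖shiftMonomial T a ha α f‖ = √(kappaCoeff a β α) * ‖f‖ := by
  have hc := kappaCoeff_pos ha β α
  have h : √(kappaCoeff a β α) * ‖shiftMonomial T a ha α f‖ = ‖f‖ := by
    rw [← Real.sqrt_sq (norm_nonneg (shiftMonomial T a ha α f)), ← Real.sqrt_mul hc.le,
      kappaCoeff_mul_norm_sq T ha hf, Real.sqrt_sq (norm_nonneg f)]
  rw [← h, ← mul_assoc, Real.mul_self_sqrt hc.le]

/-- The wandering subspace property: the vectors `S^α x`, with `x` in the joint kernel, span a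
dense subspace. If `f` is orthogonal to all of them, then so are all `S_j^* f`. Hence, if these
vanish at all vertices of total depth less than `n`, the part of `f` at a given depth of total
size `n` belongs to the joint kernel, and is orthogonal to itself. -/
theorem eq_zero_of_inner_shiftMonomial_eq_zero {a : ℝ} (ha : 0 < a) {f : L2 V}
    (hf : ∀ α, ∀ x ∈ jointKernel T a ha, inner ℂ (shiftMonomial T a ha α x) f = 0) : f = 0 := by
  have key : ∀ n : ℕ, ∀ f : L2 V,
      (∀ α, ∀ x ∈ jointKernel T a ha, inner ℂ (shiftMonomial T a ha α x) f = 0) →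
      ∀ v, absDepth T v = n → f v = 0 := by
    intro n
    induction n using Nat.strong_induction_on with
    | _ n ih =>
      intro f hf v hv
      set g := cutoff (level T (depth T v)) f with hg
      have hgE : g ∈ jointKernel T a ha := by
        rw [mem_jointKernel_iff]
        intro j u
        by_cases h : depth T u + Pi.single j 1 = depth T v
        · have hu : absDepth T u < n := by
            rw [← hv, absDepth, absDepth, ← h]
            simp [Finset.sum_add_distrib]
          have h1 := ih _ hu (ContinuousLinearMap.adjoint (shift T a ha j) f) (fun α x hx => by
            rw [ContinuousLinearMap.adjoint_inner_right, ← shiftMonomial_add_single_apply]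
            exact hf _ x hx) u rfl
          rw [adjoint_shift_apply, mul_eq_zero,
            or_iff_right (Complex.ofReal_ne_zero.2 (chiWeight_pos T ha j u).ne')] at h1
          rw [← h1]
          exact Finset.sum_congr rfl fun w hw => cutoff_of_mem f ((depth_of_mem_chi T hw).trans h)
        · exact Finset.sum_eq_zero fun w hw =>
            cutoff_of_notMem f fun hw' => h ((depth_of_mem_chi T hw).symm.trans hw')
      have h1 := hf 0 g hgE
      rw [shiftMonomial_zero_apply, ← inner_cutoff_right (isHomogeneous_cutoff T _ f), ← hg,
        inner_self_eq_zero] at h1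
      rw [← cutoff_of_mem f (s := level T (depth T v)) rfl, ← hg, h1]
      rfl
  exact lp.ext (funext fun v => key _ f hf v rfl)

/-! ### Kernel functions -/

/-- The scalar kernel `∑_α c(β, α) z^α \bar w^α` attached to vertices of depth `β`. -/
def kappaSeries (a : ℝ) (β : Fin d → ℕ) (z w : EuclideanSpace ℂ (Fin d)) : ℂ :=
  ∑' α, (kappaCoeff a β α : ℂ) * ((∏ j, z j ^ α j) * ∏ j, conj (w j) ^ α j)

theorem sum_norm_mul_norm_lt_one {z w : EuclideanSpace ℂ (Fin d)} (hz : z ∈ Metric.ball 0 1)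
    (hw : w ∈ Metric.ball 0 1) : ∑ j, ‖z j‖ * ‖w j‖ < 1 := by
  have h1 := sum_norm_sq_lt_one hz
  have h2 := sum_norm_sq_lt_one hw
  have h3 : ∑ j, ‖z j‖ * ‖w j‖ ≤ ∑ j, (‖z j‖ ^ 2 + ‖w j‖ ^ 2) / 2 :=
    Finset.sum_le_sum fun j _ => by nlinarith [sq_nonneg (‖z j‖ - ‖w j‖)]
  rw [← Finset.sum_div, Finset.sum_add_distrib] at h3
  linarith

theorem summable_kappaSeries {a : ℝ} (ha : 0 < a) (β : Fin d → ℕ)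
    {z w : EuclideanSpace ℂ (Fin d)} (hz : z ∈ Metric.ball 0 1) (hw : w ∈ Metric.ball 0 1) :
    Summable fun α : Fin d → ℕ =>
      (kappaCoeff a β α : ℂ) * ((∏ j, z j ^ α j) * ∏ j, conj (w j) ^ α j) := by
  refine Summable.of_norm ((summable_kappaCoeff ha β (t := fun j => ‖z j‖ * ‖w j‖)
    (fun j => by positivity) (sum_norm_mul_norm_lt_one hz hw)).congr fun α => ?_)
  simp [mul_pow, Finset.prod_mul_distrib, abs_of_pos (kappaCoeff_pos ha β α)]

theorem hasSum_kappaSeries_zero {a : ℝ} (ha : 0 < a)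
    {z w : EuclideanSpace ℂ (Fin d)} (hz : z ∈ Metric.ball 0 1) (hw : w ∈ Metric.ball 0 1) :
    HasSum (fun α : Fin d → ℕ =>
      (kappaCoeff a 0 α : ℂ) * ((∏ j, z j ^ α j) * ∏ j, conj (w j) ^ α j))
      ((1 - inner ℂ w z) ^ (-(a : ℂ))) := by
  have h := hasSum_kappaCoeff_zero ha (x := fun j => z j * conj (w j))
    (by simpa using sum_norm_mul_norm_lt_one hz hw)
  simp only [mul_pow, Finset.prod_mul_distrib] at h
  rwa [PiLp.inner_apply]

theorem summable_kernelVector {a : ℝ} (ha : 0 < a) {β : Fin d → ℕ} {f : L2 V}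
    (hf : IsHomogeneous T β f) {z : EuclideanSpace ℂ (Fin d)} (hz : z ∈ Metric.ball 0 1) :
    Summable fun α : Fin d → ℕ =>
      ((∏ j, conj (z j) ^ α j) * (kappaCoeff a β α : ℂ)) • shiftMonomial T a ha α f := by
  refine Summable.of_norm (((summable_sqrt_kappaCoeff ha β (fun j => norm_nonneg (z j))
    (sum_norm_sq_lt_one hz)).mul_right ‖f‖).congr fun α => ?_)
  rw [norm_smul, norm_mul, mul_assoc ‖_‖ ‖_‖, Complex.norm_real,
    Real.norm_of_nonneg (kappaCoeff_pos ha β α).le, kappaCoeff_mul_norm T ha hf]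
  simp only [norm_prod, norm_pow, RCLike.norm_conj]
  ring

open Classical in
/-- The kernel vector `∑_α c(β, α) \bar z^α S^α e_v` of a vertex `v` of depth `β`. -/
def kernelVector (a : ℝ) (ha : 0 < a) (v : ∀ j, V j) (z : EuclideanSpace ℂ (Fin d)) : L2 V :=
  ∑' α : Fin d → ℕ, ((∏ j, conj (z j) ^ α j) * (kappaCoeff a (depth T v) α : ℂ)) •
    shiftMonomial T a ha α (lp.single 2 v (1 : ℂ))

open Classical in
theorem isHomogeneous_single (v : ∀ j, V j) :
    IsHomogeneous T (depth T v) (lp.single 2 v (1 : ℂ) : L2 V) := by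
  intro w hw
  have : w ≠ v := fun h => hw (h ▸ rfl)
  simp [this]

open Classical in
theorem hasSum_kernelVector {a : ℝ} (ha : 0 < a) (v : ∀ j, V j)
    {z : EuclideanSpace ℂ (Fin d)} (hz : z ∈ Metric.ball 0 1) :
    HasSum (fun α : Fin d → ℕ => ((∏ j, conj (z j) ^ α j) * (kappaCoeff a (depth T v) α : ℂ)) •
      shiftMonomial T a ha α (lp.single 2 v (1 : ℂ))) (kernelVector T a ha v z) :=
  (summable_kernelVector T ha (isHomogeneous_single T v) hz).hasSum

/-- The adjoint of the evaluation at `z`: the linear map on the joint kernel that sends a function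
`x` of degree `β` to `∑_α c(β, α) \bar z^α S^α x`. It is written as a finite sum over the vertices
that carry the joint kernel. -/
def kernelMap (hT : ∑ j, (T j).branchingIndex ≠ ⊤) (a : ℝ) (ha : 0 < a)
    (z : EuclideanSpace ℂ (Fin d)) : jointKernel T a ha →L[ℂ] L2 V :=
  ∑ v ∈ (finite_branchingSupport T hT).toFinset,
    ((lp.evalCLM ℂ (fun _ : (∀ j, V j) => ℂ) 2 v) ∘L (jointKernel T a ha).subtypeL).smulRight
      (kernelVector T a ha v z)

theorem kernelMap_apply (hT : ∑ j, (T j).branchingIndex ≠ ⊤) {a : ℝ} (ha : 0 < a)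
    (z : EuclideanSpace ℂ (Fin d)) (x : jointKernel T a ha) :
    kernelMap T hT a ha z x = ∑ v ∈ (finite_branchingSupport T hT).toFinset,
      (x : L2 V) v • kernelVector T a ha v z := by
  simp [kernelMap, lp.evalCLM]

open Classical in
theorem sum_single_of_mem_jointKernel (hT : ∑ j, (T j).branchingIndex ≠ ⊤) {a : ℝ} (ha : 0 < a)
    {x : L2 V} (hx : x ∈ jointKernel T a ha) :
    ∑ v ∈ (finite_branchingSupport T hT).toFinset, x v • lp.single 2 v (1 : ℂ) = x := by
  ext w
  rw [lp.coeFn_sum, Finset.sum_apply, Finset.sum_eq_single w]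
  · simp
  · intro v _ hv
    simp [hv.symm]
  · intro hw
    have : x w = 0 := by
      by_contra h
      exact hw ((finite_branchingSupport T hT).mem_toFinset.2
        (mem_branchingSupport_of_mem_jointKernel T ha hx h))
    simp [this]

theorem hasSum_kernelMap (hT : ∑ j, (T j).branchingIndex ≠ ⊤) {a : ℝ} (ha : 0 < a)
    {z : EuclideanSpace ℂ (Fin d)} (hz : z ∈ Metric.ball 0 1) {β : Fin d → ℕ}
    {x : jointKernel T a ha} (hx : IsHomogeneous T β (x : L2 V)) :
    HasSum (fun α : Fin d → ℕ => ((∏ j, conj (z j) ^ α j) * (kappaCoeff a β α : ℂ)) •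
      shiftMonomial T a ha α (x : L2 V)) (kernelMap T hT a ha z x) := by
  classical
  rw [kernelMap_apply]
  have h := hasSum_sum (s := (finite_branchingSupport T hT).toFinset) fun v _ =>
    (hasSum_kernelVector T ha v hz).const_smul ((x : L2 V) v)
  refine h.congr_fun fun α => ?_
  conv_lhs => rw [← sum_single_of_mem_jointKernel T hT ha x.2]
  rw [map_sum, Finset.smul_sum]
  refine Finset.sum_congr rfl fun v _ => ?_
  by_cases hv : depth T v = β
  · rw [map_smul, smul_comm, hv]
  · simp [hx v hv]

/-- The joint kernel is spanned by its homogeneous elements. -/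
theorem jointKernel_induction (hT : ∑ j, (T j).branchingIndex ≠ ⊤) {a : ℝ} (ha : 0 < a)
    {p : jointKernel T a ha → Prop} (add : ∀ x y, p x → p y → p (x + y))
    (homogeneous : ∀ β (x : jointKernel T a ha), IsHomogeneous T β (x : L2 V) → p x)
    (x : jointKernel T a ha) : p x := by
  classical
  have hx : x = ∑ β ∈ (finite_branchingSupport T hT).toFinset.image (depth T),
      ⟨cutoff (level T β) (x : L2 V), cutoff_level_mem_jointKernel T ha β x.2⟩ := by
    ext w
    rw [Submodule.coe_sum, lp.coeFn_sum, Finset.sum_apply, Finset.sum_eq_single (depth T w)]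
    · exact (cutoff_of_mem (s := level T (depth T w)) (x : L2 V) rfl).symm
    · intro β _ hβ
      exact cutoff_of_notMem _ fun h => hβ h.symm
    · intro hw
      rw [cutoff_of_mem (s := level T (depth T w)) _ rfl]
      by_contra h
      exact hw (Finset.mem_image_of_mem _ ((finite_branchingSupport T hT).mem_toFinset.2
        (mem_branchingSupport_of_mem_jointKernel T ha x.2 h)))
  rw [hx]
  refine Finset.sum_induction _ p add (homogeneous 0 0 fun _ _ => rfl) fun β _ => ?_
  exact homogeneous β _ (isHomogeneous_cutoff T β _)

/-- The range of `kernelMap z` consists of joint eigenvectors of the adjoint shifts. -/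
theorem adjoint_shift_kernelMap (hT : ∑ j, (T j).branchingIndex ≠ ⊤) {a : ℝ} (ha : 0 < a)
    {z : EuclideanSpace ℂ (Fin d)} (hz : z ∈ Metric.ball 0 1) (j : Fin d)
    (x : jointKernel T a ha) :
    ContinuousLinearMap.adjoint (shift T a ha j) (kernelMap T hT a ha z x) =
      conj (z j) • kernelMap T hT a ha z x := by
  induction x using jointKernel_induction T hT ha with
  | add x y hx hy => rw [map_add, map_add, hx, hy, smul_add]
  | homogeneous β x hx =>
    have h := (hasSum_kernelMap T hT ha hz hx).mapL
      (ContinuousLinearMap.adjoint (shift T a ha j))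
    have hinj : Function.Injective fun α : Fin d → ℕ => α + Pi.single j 1 :=
      add_left_injective _
    -- the terms with `α j = 0` vanish, so that the sum may be restricted to `α + e_j`
    rw [← hinj.hasSum_iff] at h
    · refine h.unique (((hasSum_kernelMap T hT ha hz hx).const_smul (conj (z j))).congr_fun
        fun α => ?_)
      have hp : ∏ k, conj (z k) ^ (α + Pi.single j 1 : Fin d → ℕ) k =
          conj (z j) * ∏ k, conj (z k) ^ α k := by
        simp only [Pi.add_apply, pow_add, Finset.prod_mul_distrib]
        rw [mul_comm, Finset.prod_eq_single j (fun k _ hk => by simp [hk]) (by simp)]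
        simp
      simp only [Function.comp_apply, map_smul]
      rw [hp, mul_smul, adjoint_shift_shiftMonomial T ha hx, smul_smul, smul_smul, mul_assoc]
    · intro α hα
      have hαj : α j = 0 := by
        by_contra h0
        refine hα ⟨α - Pi.single j 1, ?_⟩
        funext k
        by_cases hk : k = j
        · subst hk; simp; omega
        · simp [hk]
      have hx0 : ContinuousLinearMap.adjoint (shift T a ha j) (x : L2 V) = 0 :=
        (adjoint_shift_eq_zero_iff T ha j _).2 ((mem_jointKernel_iff T ha).1 x.2 j)
      rw [map_smul, adjoint_shift_shiftMonomial_eq_zero T ha hx0 hαj, smul_zero]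

theorem inner_shiftMonomial_kernelMap (hT : ∑ j, (T j).branchingIndex ≠ ⊤) {a : ℝ} (ha : 0 < a)
    {z : EuclideanSpace ℂ (Fin d)} (hz : z ∈ Metric.ball 0 1) (x : jointKernel T a ha) (f : L2 V)
    (α : Fin d → ℕ) : inner ℂ (shiftMonomial T a ha α f) (kernelMap T hT a ha z x) =
      (∏ j, conj (z j) ^ α j) * inner ℂ f (kernelMap T hT a ha z x) := by
  induction α using multiIndex_induction with
  | zero => simp [shiftMonomial_zero_apply]
  | add_single α j ih =>
    rw [shiftMonomial_add_single_apply, ← ContinuousLinearMap.adjoint_inner_right,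
      adjoint_shift_kernelMap T hT ha hz, inner_smul_right, ih, ← mul_assoc]
    congr 1
    simp only [Pi.add_apply, pow_add, Finset.prod_mul_distrib]
    rw [mul_comm, Finset.prod_eq_single (f := fun k => conj (z k) ^ (Pi.single j 1 : Fin d → ℕ) k)
      j (fun k _ hk => by simp [hk]) (by simp)]
    simp

theorem inner_shiftMonomial_eq_zero {a : ℝ} (ha : 0 < a) {y : L2 V}
    (hy : y ∈ jointKernel T a ha) (f : L2 V) {α : Fin d → ℕ} (hα : α ≠ 0) :
    inner ℂ y (shiftMonomial T a ha α f) = 0 := by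
  induction α using multiIndex_induction with
  | zero => exact absurd rfl hα
  | add_single α j _ =>
    rw [shiftMonomial_add_single_apply, ← ContinuousLinearMap.adjoint_inner_left,
      (adjoint_shift_eq_zero_iff T ha j y).2 ((mem_jointKernel_iff T ha).1 hy j), inner_zero_left]

/-- Only the term `α = 0` of `kernelMap z x` survives against the joint kernel. -/
theorem inner_kernelMap_right (hT : ∑ j, (T j).branchingIndex ≠ ⊤) {a : ℝ} (ha : 0 < a)
    {z : EuclideanSpace ℂ (Fin d)} (hz : z ∈ Metric.ball 0 1) (x y : jointKernel T a ha) :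
    inner ℂ (y : L2 V) (kernelMap T hT a ha z x) = inner ℂ (y : L2 V) (x : L2 V) := by
  induction x using jointKernel_induction T hT ha with
  | add x x' hx hx' =>
    rw [map_add, inner_add_right, hx, hx', Submodule.coe_add, inner_add_right]
  | homogeneous β x hx =>
    have h := (hasSum_kernelMap T hT ha hz hx).mapL (innerSL ℂ (y : L2 V))
    simp only [innerSL_apply_apply, inner_smul_right] at h
    have h' := hasSum_single (f := fun α : Fin d → ℕ => ((∏ j, conj (z j) ^ α j) *
      (kappaCoeff a β α : ℂ)) * inner ℂ (y : L2 V) (shiftMonomial T a ha α (x : L2 V))) 0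
      fun α hα => by rw [inner_shiftMonomial_eq_zero T ha y.2 _ hα, mul_zero]
    rw [h.unique h']
    simp [kappaCoeff_zero_right, shiftMonomial_zero_apply]

theorem hasSum_inner_kernelMap_left (hT : ∑ j, (T j).branchingIndex ≠ ⊤) {a : ℝ} (ha : 0 < a)
    {z : EuclideanSpace ℂ (Fin d)} (hz : z ∈ Metric.ball 0 1) {β : Fin d → ℕ}
    {x : jointKernel T a ha} (hx : IsHomogeneous T β (x : L2 V)) (f : L2 V) :
    HasSum (fun α : Fin d → ℕ => ((kappaCoeff a β α : ℂ) *
      inner ℂ (shiftMonomial T a ha α (x : L2 V)) f) * ∏ j, z j ^ α j)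
      (inner ℂ (kernelMap T hT a ha z x) f) := by
  have h := ((hasSum_kernelMap T hT ha hz hx).mapL (innerSL ℂ f)).star
  simp only [innerSL_apply_apply, RCLike.star_def, inner_conj_symm] at h
  refine h.congr_fun fun α => ?_
  rw [inner_smul_left]
  simp
  ring

theorem inner_kernelMap_kernelMap (hT : ∑ j, (T j).branchingIndex ≠ ⊤) {a : ℝ} (ha : 0 < a)
    {z w : EuclideanSpace ℂ (Fin d)} (hz : z ∈ Metric.ball 0 1) (hw : w ∈ Metric.ball 0 1)
    {β : Fin d → ℕ} {y : jointKernel T a ha} (hy : IsHomogeneous T β (y : L2 V))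
    (x : jointKernel T a ha) :
    inner ℂ (kernelMap T hT a ha z y) (kernelMap T hT a ha w x) =
      kappaSeries a β z w * inner ℂ (y : L2 V) (x : L2 V) := by
  refine (hasSum_inner_kernelMap_left T hT ha hz hy _).unique ?_
  refine ((summable_kappaSeries ha β hz hw).hasSum.mul_right _).congr_fun fun α => ?_
  rw [inner_shiftMonomial_kernelMap T hT ha hw, inner_kernelMap_right T hT ha hw]
  ring

/-- The reproducing kernel acts on the joint kernel as a diagonal operator whose entries depend
on the depth only. -/
theorem adjoint_kernelMap_kernelMap_apply (hT : ∑ j, (T j).branchingIndex ≠ ⊤) {a : ℝ}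
    (ha : 0 < a) {z w : EuclideanSpace ℂ (Fin d)} (hz : z ∈ Metric.ball 0 1)
    (hw : w ∈ Metric.ball 0 1) (x : jointKernel T a ha) (v : ∀ j, V j) :
    (ContinuousLinearMap.adjoint (kernelMap T hT a ha z) (kernelMap T hT a ha w x) : L2 V) v =
      kappaSeries a (depth T v) z w * (x : L2 V) v := by
  set q := ContinuousLinearMap.adjoint (kernelMap T hT a ha z) (kernelMap T hT a ha w x) with hq
  set k := kappaSeries a (depth T v) z w
  set s := level T (depth T v)
  -- the component of `q - k x` at the depth of `v` is orthogonal to itself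
  let g : jointKernel T a ha := ⟨cutoff s ((q : L2 V) - k • (x : L2 V)),
    cutoff_level_mem_jointKernel T ha _ (q - k • x).2⟩
  have hg : IsHomogeneous T (depth T v) (g : L2 V) := isHomogeneous_cutoff T _ _
  have h0 : inner ℂ (g : L2 V) (g : L2 V) = 0 := by
    change inner ℂ (g : L2 V) (cutoff s ((q : L2 V) - k • (x : L2 V))) = 0
    rw [inner_cutoff_right hg, inner_sub_right, inner_smul_right, ← Submodule.coe_inner, hq,
      ContinuousLinearMap.adjoint_inner_right, inner_kernelMap_kernelMap T hT ha hz hw hg,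
      sub_self]
  have h1 : cutoff s ((q : L2 V) - k • (x : L2 V)) v = 0 := by
    have := inner_self_eq_zero.1 h0
    change (g : L2 V) v = 0
    rw [this]
    rfl
  rw [cutoff_of_mem (s := s) _ rfl] at h1
  exact sub_eq_zero.1 h1

/-- A vector all of whose evaluations vanish is zero: comparing coefficients, it is orthogonal to
all `S^α x` with `x` in the joint kernel. -/
theorem eq_zero_of_adjoint_kernelMap_eq_zero (hT : ∑ j, (T j).branchingIndex ≠ ⊤) {a : ℝ}
    (ha : 0 < a) {f : L2 V} (hf : ∀ z ∈ Metric.ball (0 : EuclideanSpace ℂ (Fin d)) 1,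
      ContinuousLinearMap.adjoint (kernelMap T hT a ha z) f = 0) : f = 0 := by
  refine eq_zero_of_inner_shiftMonomial_eq_zero T ha fun α x hx => ?_
  lift x to jointKernel T a ha using hx
  induction x using jointKernel_induction T hT ha with
  | add x y hx hy => rw [Submodule.coe_add, map_add, inner_add_left, hx, hy, add_zero]
  | homogeneous β x hx =>
    -- the ball contains a polydisc, on which coefficients can be compared
    have hr : (0 : ℝ) < 1 / (d + 1) := by positivity
    have h := powerSeries_coeff_eq_zero_of_polydisc hr (b := fun α : Fin d → ℕ =>
      (kappaCoeff a β α : ℂ) * inner ℂ (shiftMonomial T a ha α (x : L2 V)) f) fun z hz => by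
        have hzb : WithLp.toLp 2 z ∈ Metric.ball (0 : EuclideanSpace ℂ (Fin d)) 1 := by
          rw [mem_ball_zero_iff, ← sq_lt_one_iff₀ (norm_nonneg _), EuclideanSpace.norm_sq_eq]
          have hj : ∀ j ∈ Finset.univ, ‖z j‖ ^ 2 ≤ 1 / (d + 1 : ℝ) := fun j _ => by
            have h1 : 1 / (d + 1 : ℝ) ≤ 1 := (div_le_one (by positivity)).2 (by simp)
            nlinarith [norm_nonneg (z j), (hz j).le]
          refine (Finset.sum_le_card_nsmul _ _ _ hj).trans_lt ?_
          rw [Finset.card_univ, Fintype.card_fin, nsmul_eq_mul, mul_one_div,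
            div_lt_one (by positivity)]
          exact lt_add_one _
        have h1 := hasSum_inner_kernelMap_left T hT ha hzb hx f
        rwa [← ContinuousLinearMap.adjoint_inner_right, hf _ hzb, inner_zero_right] at h1
    have hα := congrFun h α
    exact (mul_eq_zero.1 hα).resolve_left
      (Complex.ofReal_ne_zero.2 (kappaCoeff_pos ha β α).ne')

theorem adjoint_kernelMap_shift (hT : ∑ j, (T j).branchingIndex ≠ ⊤) {a : ℝ} (ha : 0 < a)
    {z : EuclideanSpace ℂ (Fin d)} (hz : z ∈ Metric.ball 0 1) (j : Fin d) (f : L2 V) :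
    ContinuousLinearMap.adjoint (kernelMap T hT a ha z) (shift T a ha j f) =
      z j • ContinuousLinearMap.adjoint (kernelMap T hT a ha z) f := by
  refine ext_inner_left ℂ fun x => ?_
  rw [ContinuousLinearMap.adjoint_inner_right, ← ContinuousLinearMap.adjoint_inner_left,
    adjoint_shift_kernelMap T hT ha hz, inner_smul_left, inner_smul_right (𝕜 := ℂ) x,
    ContinuousLinearMap.adjoint_inner_right, RCLike.conj_conj]

open Classical in
theorem differentiableOn_inner_kernelVector {a : ℝ} (ha : 0 < a) (v : ∀ j, V j) (f : L2 V) :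
    DifferentiableOn ℂ (fun z => inner ℂ (kernelVector T a ha v z) f) (Metric.ball 0 1) := by
  have hb : ∀ t : Fin d → ℝ, (∀ j, 0 ≤ t j) → ∑ j, t j ^ 2 < 1 → Summable fun α : Fin d → ℕ =>
      ‖(kappaCoeff a (depth T v) α : ℂ) *
        inner ℂ (shiftMonomial T a ha α (lp.single 2 v (1 : ℂ))) f‖ * ∏ j, t j ^ α j := by
    intro t ht hs
    refine Summable.of_nonneg_of_le
      (fun α => mul_nonneg (norm_nonneg _) (Finset.prod_nonneg fun j _ => pow_nonneg (ht j) _))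
      (fun α => ?_) ((summable_sqrt_kappaCoeff ha (depth T v) ht hs).mul_right
        (‖(lp.single 2 v (1 : ℂ) : L2 V)‖ * ‖f‖))
    rw [mul_right_comm, ← mul_assoc (√_), ← kappaCoeff_mul_norm T ha (isHomogeneous_single T v)]
    refine mul_le_mul_of_nonneg_right ?_ (Finset.prod_nonneg fun j _ => pow_nonneg (ht j) _)
    rw [norm_mul, Complex.norm_real, Real.norm_of_nonneg (kappaCoeff_pos ha _ α).le, mul_assoc]
    exact mul_le_mul_of_nonneg_left (norm_inner_le_norm _ _) (kappaCoeff_pos ha _ α).le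
  refine (differentiableOn_tsum_monomial hb).congr fun z hz => ?_
  have h := ((hasSum_kernelVector T ha v hz).mapL (innerSL ℂ f)).star
  simp only [innerSL_apply_apply, RCLike.star_def, inner_conj_symm] at h
  rw [← h.tsum_eq]
  refine tsum_congr fun α => ?_
  rw [inner_smul_left]
  simp
  ring

/-- The function on the ball represented by `f` is holomorphic. -/
theorem differentiableOn_adjoint_kernelMap (hT : ∑ j, (T j).branchingIndex ≠ ⊤) {a : ℝ}
    (ha : 0 < a) (f : L2 V) :
    DifferentiableOn ℂ (fun z => ContinuousLinearMap.adjoint (kernelMap T hT a ha z) f)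
      (Metric.ball 0 1) := by
  classical
  have h : ∀ z, ContinuousLinearMap.adjoint (kernelMap T hT a ha z) f =
      ∑ v ∈ (finite_branchingSupport T hT).toFinset, inner ℂ (kernelVector T a ha v z) f •
        (jointKernel T a ha).orthogonalProjectionOnto (lp.single 2 v (1 : ℂ)) := by
    intro z
    refine ext_inner_left ℂ fun x => ?_
    rw [ContinuousLinearMap.adjoint_inner_right, kernelMap_apply, sum_inner, inner_sum]
    refine Finset.sum_congr rfl fun v _ => ?_
    rw [inner_smul_left, inner_smul_right (𝕜 := ℂ) x,
      Submodule.inner_orthogonalProjectionOnto_eq_of_mem_left,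
      lp.inner_single_right]
    simp [mul_comm]
  simp only [h]
  exact DifferentiableOn.fun_sum fun v _ =>
    (differentiableOn_inner_kernelVector T ha v f).smul_const _

/-! ### The sum over the classes of siblings -/

theorem kappa_eq (a : ℝ) (u : ∀ j, V j) (F : Finset (Fin d)) (z w : EuclideanSpace ℂ (Fin d)) :
    kappa T a u F z w =
      kappaSeries a (depth T u) z w • (solutionSpace T a u F).starProjection := rfl

theorem finite_solutionSpace_ne_bot (hT : ∑ j, (T j).branchingIndex ≠ ⊤) {a : ℝ} (ha : 0 < a)
    {Ω : Finset (Fin d) → Set (∀ j, V j)} (hΩ : IsIndexing T Ω) (F : Finset (Fin d)) :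
    {u | u ∈ Ω F ∧ solutionSpace T a u F ≠ ⊥}.Finite :=
  (finite_branchingSupport T hT).subset fun _ h =>
    mem_branchingSupport_of_solutionSpace_ne_bot T ha ((hΩ F).1 h.1) h.2

open Classical in
/-- On the joint kernel the operators `κ_{u,F}`, `u ∈ Ω_F`, add up to a diagonal operator
supported on `Φ_F`, since the classes `sib_F(u)` partition `Φ_F`. -/
theorem finsum_kappa_apply (hT : ∑ j, (T j).branchingIndex ≠ ⊤) {a : ℝ} (ha : 0 < a)
    {Ω : Finset (Fin d) → Set (∀ j, V j)} (hΩ : IsIndexing T Ω) (F : Finset (Fin d))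
    (z w : EuclideanSpace ℂ (Fin d)) {x : L2 V} (hx : x ∈ jointKernel T a ha) (v : ∀ j, V j) :
    (∑ᶠ u ∈ Ω F, kappa T a u F z w) x v =
      if v ∈ Phi T F then kappaSeries a (depth T v) z w * x v else 0 := by
  let φ : (L2 V →L[ℂ] L2 V) →+ ℂ :=
    { toFun := fun A => A x v
      map_zero' := rfl
      map_add' := fun A B => rfl }
  have hfin : (Ω F ∩ Function.support fun u => kappa T a u F z w).Finite := by
    refine (finite_solutionSpace_ne_bot T hT ha hΩ F).subset fun u hu => ⟨hu.1, fun h => hu.2 ?_⟩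
    simp only [kappa_eq, h, Submodule.starProjection_bot, smul_zero]
  have hterm : ∀ u ∈ Ω F, φ (kappa T a u F z w) =
      kappaSeries a (depth T u) z w * cutoff (sibF T F u) x v := by
    intro u hu
    rw [← starProjection_solutionSpace T ha ((hΩ F).1 hu) hx]
    rfl
  change φ _ = _
  rw [φ.map_finsum_mem' hfin]
  split_ifs with hv
  · obtain ⟨u₀, ⟨hu₀, hs⟩, huniq⟩ := (hΩ F).2 v hv
    rw [finsum_eq_single _ u₀ fun u hu => ?_]
    · rw [finsum_eq_if, if_pos hu₀, hterm u₀ hu₀, cutoff_of_mem x (mem_sibF_comm T hs),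
        depth_of_mem_sibF T hs]
    · by_cases hmem : u ∈ Ω F
      swap
      · rw [finsum_eq_if, if_neg hmem]
      rw [finsum_eq_if, if_pos hmem, hterm u hmem,
        cutoff_of_notMem x fun h => hu (huniq u ⟨hmem, mem_sibF_comm T h⟩),
        mul_zero]
  · refine finsum_mem_eq_zero_of_forall_eq_zero fun u hu => ?_
    rw [hterm u hu, cutoff_of_notMem x fun h => hv (mem_Phi_of_mem_sibF T ((hΩ F).1 hu) h),
      mul_zero]

theorem mem_Phi_iff (F : Finset (Fin d)) (v : ∀ j, V j) [DecidablePred fun j => v j ≠ (T j).root] :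
    v ∈ Phi T F ↔ F = Finset.univ.filter fun j => v j ≠ (T j).root := by
  rw [Finset.ext_iff]
  simp only [Finset.mem_filter, Finset.mem_univ, true_and]
  exact forall_congr' fun j => Iff.comm

/-- The right hand side of the formula for the kernel, evaluated at a vertex. -/
theorem kernelFormula_apply (hT : ∑ j, (T j).branchingIndex ≠ ⊤) {a : ℝ} (ha : 0 < a)
    {Ω : Finset (Fin d) → Set (∀ j, V j)} (hΩ : IsIndexing T Ω)
    {z w : EuclideanSpace ℂ (Fin d)} (hz : z ∈ Metric.ball 0 1) (hw : w ∈ Metric.ball 0 1)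
    {x : L2 V} (hx : x ∈ jointKernel T a ha) (v : ∀ j, V j) :
    ((1 - inner ℂ w z) ^ (-(a : ℂ)) • (rootSpace T).starProjection +
      ∑ F : Finset (Fin d) with F.Nonempty, ∑ᶠ u ∈ Ω F, kappa T a u F z w) x v =
        kappaSeries a (depth T v) z w * x v := by
  classical
  have hsum : ((∑ F : Finset (Fin d) with F.Nonempty, ∑ᶠ u ∈ Ω F, kappa T a u F z w) x : L2 V) v =
      ∑ F : Finset (Fin d) with F.Nonempty,
        if v ∈ Phi T F then kappaSeries a (depth T v) z w * x v else 0 := by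
    rw [sum_apply, lp.coeFn_sum, Finset.sum_apply]
    exact Finset.sum_congr rfl fun F _ => finsum_kappa_apply T hT ha hΩ F z w hx v
  have hroot : (((1 - inner ℂ w z) ^ (-(a : ℂ)) • (rootSpace T).starProjection) x : L2 V) v =
      (1 - inner ℂ w z) ^ (-(a : ℂ)) * cutoff {root T} x v := by
    rw [← starProjection_rootSpace]
    rfl
  rw [add_apply, lp.coeFn_add, Pi.add_apply, hsum, hroot]
  simp only [mem_Phi_iff]
  rw [Finset.sum_ite_eq']
  by_cases hv : v = root T
  · subst hv
    rw [cutoff_of_mem (s := {root T}) x rfl, depth_root, kappaSeries,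
      (hasSum_kappaSeries_zero ha hz hw).tsum_eq, if_neg (by simp [root]), add_zero]
  · rw [cutoff_of_notMem (s := {root T}) x hv, mul_zero, zero_add, if_pos]
    obtain ⟨j, hj⟩ := Function.ne_iff.1 hv
    simp only [Finset.mem_filter, Finset.mem_univ, true_and]
    exact ⟨j, Finset.mem_filter.2 ⟨Finset.mem_univ j, hj⟩⟩

/-- `ℓ²(V)` as a space of functions on the ball: `f` is identified with the function
`z ↦ K_z^* f`, where `K_z` is `kernelMap z`. -/
@[reducible]
def functionModel (hT : ∑ j, (T j).branchingIndex ≠ ⊤) (a : ℝ) (ha : 0 < a) :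
    RKHS ℂ (L2 V) (Metric.ball (0 : EuclideanSpace ℂ (Fin d)) 1) (jointKernel T a ha) where
  coeCLM := ContinuousLinearMap.pi fun z => ContinuousLinearMap.adjoint (kernelMap T hT a ha z)
  coeCLM_injective := by
    refine (injective_iff_map_eq_zero
      (ContinuousLinearMap.pi fun z : Metric.ball (0 : EuclideanSpace ℂ (Fin d)) 1 =>
        ContinuousLinearMap.adjoint (kernelMap T hT a ha z))).2 fun f hf => ?_
    exact eq_zero_of_adjoint_kernelMap_eq_zero T hT ha fun z hz => congrFun hf ⟨z, hz⟩

end TreeProduct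

end

theorem mainTheorem2 {d : ℕ} (hd : 0 < d) {V : Fin d → Type u}
    (T : ∀ j, DirTree (V j))
    (hT : ∑ j, (T j).branchingIndex ≠ ⊤)
    (a : ℝ) (ha : 0 < a)
    (Ω : Finset (Fin d) → Set (∀ j, V j)) (hΩ : TreeProduct.IsIndexing T Ω) :
    -- the sum over `F ≠ ∅` and `u ∈ Ω_F` in the kernel has only finitely many nonzero terms
    {p : Finset (Fin d) × (∀ j, V j) | p.1.Nonempty ∧ p.2 ∈ Ω p.1 ∧
      TreeProduct.solutionSpace T a p.2 p.1 ≠ ⊥}.Finite ∧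
    -- the scalar series converge on the ball
    (∀ z ∈ Metric.ball (0 : EuclideanSpace ℂ (Fin d)) 1,
      ∀ w ∈ Metric.ball (0 : EuclideanSpace ℂ (Fin d)) 1,
        HasSum (fun α : Fin d → ℕ =>
          (((∏ i ∈ Finset.range (∑ j, α j), (a + i)) / ∏ j, ((α j).factorial : ℝ) : ℝ) : ℂ) *
            ((∏ j, z j ^ α j) * ∏ j, conj (w j) ^ α j))
          ((1 - inner ℂ w z) ^ (-(a : ℂ))) ∧
        ∀ F : Finset (Fin d), F.Nonempty → ∀ u ∈ Ω F,
          Summable (TreeProduct.kappaTerm T a u z w)) ∧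
    -- the model space of holomorphic functions on the ball, with values in the joint kernel
    ∃ (H : Type u) (_ : NormedAddCommGroup H) (_ : InnerProductSpace ℂ H) (_ : CompleteSpace H)
      (_ : RKHS ℂ H (Metric.ball (0 : EuclideanSpace ℂ (Fin d)) 1)
        (TreeProduct.jointKernel T a ha))
      (M : Fin d → H →L[ℂ] H) (U : L2 V ≃ₗᵢ[ℂ] H),
      (∀ h : H, ∃ φ : EuclideanSpace ℂ (Fin d) → TreeProduct.jointKernel T a ha,
        DifferentiableOn ℂ φ (Metric.ball 0 1) ∧
        ∀ z : Metric.ball (0 : EuclideanSpace ℂ (Fin d)) 1, h z = φ z) ∧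
      (∀ j (h : H) (z : Metric.ball (0 : EuclideanSpace ℂ (Fin d)) 1),
        M j h z = (z : EuclideanSpace ℂ (Fin d)) j • h z) ∧
      (∀ j f, U (TreeProduct.shift T a ha j f) = M j (U f)) ∧
      ∀ z w : Metric.ball (0 : EuclideanSpace ℂ (Fin d)) 1,
        (TreeProduct.jointKernel T a ha).subtypeL ∘L RKHS.kernel H z w =
          ((1 - inner ℂ (w : EuclideanSpace ℂ (Fin d)) (z : EuclideanSpace ℂ (Fin d))) ^
              (-(a : ℂ)) • (TreeProduct.rootSpace T).starProjection +
            ∑ F : Finset (Fin d) with F.Nonempty, ∑ᶠ u ∈ Ω F, TreeProduct.kappa T a u F z w) ∘L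
          (TreeProduct.jointKernel T a ha).subtypeL := by
  refine ⟨?_, fun z hz w hw => ⟨?_, fun F _ u _ => TreeProduct.summable_kappaSeries ha _ hz hw⟩, ?_⟩
  · refine ((Set.finite_univ (α := Finset (Fin d))).biUnion fun F _ =>
      (TreeProduct.finite_solutionSpace_ne_bot T hT ha hΩ F).image (Prod.mk F)).subset ?_
    rintro ⟨F, u⟩ ⟨-, hu, h⟩
    exact Set.mem_biUnion (Set.mem_univ F) ⟨u, ⟨hu, h⟩, rfl⟩
  · refine (TreeProduct.hasSum_kappaSeries_zero ha hz hw).congr_fun fun α => ?_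
    rw [TreeProduct.kappaCoeff_zero_left]
  let R := TreeProduct.functionModel T hT a ha
  refine ⟨L2 V, inferInstance, inferInstance, inferInstance, R, TreeProduct.shift T a ha,
    LinearIsometryEquiv.refl ℂ _, fun f => ⟨_,
      TreeProduct.differentiableOn_adjoint_kernelMap T hT ha f, fun z => rfl⟩,
    fun j f z => TreeProduct.adjoint_kernelMap_shift T hT ha z.2 j f, fun j f => rfl, ?_⟩
  intro z w
  ext x v
  have hker : ∀ z : Metric.ball (0 : EuclideanSpace ℂ (Fin d)) 1,
      RKHS.kerFun (L2 V) z = TreeProduct.kernelMap T hT a ha z := fun z =>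
    ContinuousLinearMap.adjoint_adjoint _
  rw [RKHS.kernel_apply, hker, hker]
  exact (TreeProduct.adjoint_kernelMap_kernelMap_apply T hT ha z.2 w.2 x v).trans
    (TreeProduct.kernelFormula_apply T hT ha hΩ z.2 w.2 x.2 v).symm
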